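/- Let $\mathcal{L}\subset\mathbb{P}^2_{\mathbb{C}}$ be a real arrangement of $d\ge 4$ lines, that is, a finite set of $d$ distinct lines in the complex projective plane each of which is the zero locus of a nonzero linear form with real coefficients. For $r\ge 2$ let $t_r$ be the number of points of $\mathbb{P}^2_{\mathbb{C}}$ lying on exactly $r$ of the lines, and put $f_0=\sum_{r\ge 2}t_r$ and $f_1=\sum_{r\ge 2}r\,t_r$. Suppose that $t_d=t_{d-1}=0$. Then $3-2d+f_1-f_0>0$, so the characteristic number $$\gamma(\mathcal{L})=\frac{9-5d+3f_1-4f_0}{3-2d+f_1-f_0}$$ is well defined, and $$\gamma(\mathcal{L})\le\frac{5}{2}.$$ Moreover, $\gamma(\mathcal{L})=\frac52$ if and only if $\mathcal{L}$ is simplicial, i.e. every connected component of $\mathbb{P}^2_{\mathbb{R}}\setminus\bigcup_{\ell\in\mathcal{L}}\ell$ is an open two-dimensional simplex. Here an open two-dimensional simplex in $\mathbb{P}^2_{\mathbb{R}}$ is a set of the form $\{[c_0v_0+c_1v_1+c_2v_2] : c_0,c_1,c_2>0\}$ for some basis $v_0,v_1,v_2$ of $\mathbb{R}^3$. -/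

import Mathlib

open scoped LinearAlgebra.Projectivization

/-- The complex projective plane. -/
abbrev CP2 : Type := ℙ ℂ (Fin 3 → ℂ)

/-- The real projective plane. -/
abbrev RP2 : Type := ℙ ℝ (Fin 3 → ℝ)

/-- The quotient topology that the real projective plane gets from `ℝ³ \ {0}`. -/
noncomputable instance RP2.instTopologicalSpace : TopologicalSpace RP2 :=
  TopologicalSpace.coinduced
    (Projectivization.mk' ℝ : {v : Fin 3 → ℝ // v ≠ 0} → RP2) inferInstance

/-- The coordinatewise inclusion of `ℝ³` into `ℂ³`. -/
def complexify : (Fin 3 → ℝ) →ₛₗ[Complex.ofRealHom] (Fin 3 → ℂ) where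
  toFun v i := (v i : ℂ)
  map_add' v w := by ext i; simp
  map_smul' c v := by ext i; simp

theorem complexify_injective : Function.Injective complexify := by
  intro v w h
  ext i
  exact Complex.ofReal_injective (congrFun h i)

/-- The canonical embedding of the real projective plane into the complex one. -/
noncomputable def RP2.toCP2 : RP2 → CP2 := Projectivization.map complexify complexify_injective

/-- The zero locus in the complex projective plane of the linear form with coefficients `a`. -/
def zeroLocus (a : Fin 3 → ℂ) : Set CP2 :=
  {p | ∀ v ∈ p.submodule, ∑ i, a i * v i = 0}

/-- A line of the complex projective plane that is defined over the real numbers: the zero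
locus of a nonzero linear form with real coefficients. -/
def IsRealLine (l : Set CP2) : Prop :=
  ∃ a : Fin 3 → ℝ, a ≠ 0 ∧ l = zeroLocus (complexify a)

/-- A real line arrangement: a finite set of (pairwise distinct) lines in the complex projective
plane, each of them defined over the real numbers. -/
structure RealLineArrangement where
  lines : Finset (Set CP2)
  isRealLine : ∀ l ∈ lines, IsRealLine l

namespace RealLineArrangement

variable (L : RealLineArrangement)

/-- The number `d` of lines. -/
def d : ℕ := L.lines.card

/-- The multiplicity of a point: the number of lines of the arrangement through it. -/
noncomputable def mult (p : CP2) : ℕ := {l | l ∈ L.lines ∧ p ∈ l}.ncard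

/-- `t_r`: the number of points at which exactly `r` lines of the arrangement meet
(used for `r ≥ 2`, where this set of points is finite). -/
noncomputable def t (r : ℕ) : ℕ := {p : CP2 | L.mult p = r}.ncard

/-- `f₀ = ∑_{r ≥ 2} t_r`; there are no points of multiplicity larger than `d`. -/
noncomputable def f₀ : ℕ := ∑ r ∈ Finset.Icc 2 L.d, L.t r

/-- `f₁ = ∑_{r ≥ 2} r t_r`. -/
noncomputable def f₁ : ℕ := ∑ r ∈ Finset.Icc 2 L.d, r * L.t r

/-- The first log Chern number `9 - 5d + 3f₁ - 4f₀`. -/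
noncomputable def logChernOneSq : ℤ := 9 - 5 * L.d + 3 * L.f₁ - 4 * L.f₀

/-- The second log Chern number `3 - 2d + f₁ - f₀`. -/
noncomputable def logChernTwo : ℤ := 3 - 2 * L.d + L.f₁ - L.f₀

/-- The characteristic number `γ(L)`, the quotient of the two log Chern numbers. -/
noncomputable def charNumber : ℝ := (L.logChernOneSq : ℝ) / (L.logChernTwo : ℝ)

/-- The complement of the lines of the arrangement in the real projective plane. -/
def realComplement : Set RP2 := {x | ∀ l ∈ L.lines, x.toCP2 ∉ l}

end RealLineArrangement

/-- Open two-dimensional simplices (open triangles) in the real projective plane: for some basis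
`v₀, v₁, v₂` of `ℝ³`, the set of all points `[c₀ v₀ + c₁ v₁ + c₂ v₂]` with `c₀, c₁, c₂ > 0`, that
is, one of the triangles with vertices `[v₀]`, `[v₁]`, `[v₂]`, without its boundary. -/
def IsOpenTriangle (s : Set RP2) : Prop :=
  ∃ v : Fin 3 → (Fin 3 → ℝ), LinearIndependent ℝ v ∧
    s = {x | ∃ c : Fin 3 → ℝ, (∀ i, 0 < c i) ∧ ∑ i, c i • v i ∈ x.submodule}

/-- The arrangement is simplicial: every connected component of the complement of its lines in
the real projective plane is an open two-dimensional simplex. -/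
def RealLineArrangement.IsSimplicial (L : RealLineArrangement) : Prop :=
  ∀ x ∈ L.realComplement, IsOpenTriangle (connectedComponentIn L.realComplement x)

/-!
Since `2 (9 - 5 d + 3 f₁ - 4 f₀) = 5 (3 - 2 d + f₁ - f₀) + (3 + f₁ - 3 f₀)`, the bound on `γ` is
Melchior's inequality `3 + f₁ ≤ 3 f₀`, once the denominator is known to be positive.

In `ℝ³` the lines become planes through the origin, and these cut out `2 (1 + f₁ - f₀)` open convex
cones, two for each region of the projective plane: adding a plane cuts in two the cones that it
meets, and there are twice as many of these as there are intersection points on the new line. As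
`t_d = 0`, no two opposite vectors lie in the closure of the same cone. Hence each closed cone is
generated by its edges, so that it has at least three of them, and exactly three if and only if it
is spanned by a basis. A point of multiplicity `m` lies on the boundary of `4 m` cones, so counting
the incidences between points and cones gives `3 * 2 (1 + f₁ - f₀) ≤ 4 f₁`, which is Melchior's
inequality, with equality if and only if all the regions are triangles.

The denominator is positive because there are many intersection points. If only double points
occur, then `f₁ - f₀ = d (d - 1) / 2`. Otherwise take a point of multiplicity `m` with
`3 ≤ m ≤ d - 2`. It contributes `m - 1` to `f₁ - f₀`, and each of the `d - m` lines that miss it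
contributes at least `m` more.
-/

section Cones

variable {𝕜 V ι : Type*} [Field 𝕜] [LinearOrder 𝕜] [IsStrictOrderedRing 𝕜] [AddCommGroup V]
  [Module 𝕜 V] {g : ι → Module.Dual 𝕜 V} {A : Finset ι} {v w : V}

/-- The open convex cone on which the linear forms `g i` with `i ∈ A` are positive. -/
def openCone (g : ι → Module.Dual 𝕜 V) (A : Finset ι) : ConvexCone 𝕜 V where
  carrier := {v | ∀ i ∈ A, 0 < g i v}
  smul_mem' c hc v hv i hi := by simpa using mul_pos hc (hv i hi)
  add_mem' v hv w hw i hi := by simpa using add_pos (hv i hi) (hw i hi)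

@[simp]
theorem mem_openCone : v ∈ openCone g A ↔ ∀ i ∈ A, 0 < g i v := Iff.rfl

/-- The closed convex cone on which all the linear forms `g i` are nonnegative. -/
def closedCone (g : ι → Module.Dual 𝕜 V) : PointedCone 𝕜 V where
  carrier := {v | ∀ i, 0 ≤ g i v}
  zero_mem' := by simp
  smul_mem' c v hv i := (mul_nonneg c.2 (hv i)).trans_eq (map_smul (g i) c.1 v).symm
  add_mem' hv hw i := by simpa using add_nonneg (hv i) (hw i)

@[simp]
theorem mem_closedCone : v ∈ closedCone g ↔ ∀ i, 0 ≤ g i v := Iff.rfl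

theorem exists_pos_add_smul_mem_openCone (hv : v ∈ openCone g A) (w : V) :
    ∃ ε : 𝕜, 0 < ε ∧ v + ε • w ∈ openCone g A := by
  set M : 𝕜 := ∑ i ∈ A, |g i w| / g i v
  have hterm : ∀ i ∈ A, 0 ≤ |g i w| / g i v := fun i hi =>
    div_nonneg (abs_nonneg _) (hv i hi).le
  have hpos : 0 < 1 + M := add_pos_of_pos_of_nonneg one_pos (Finset.sum_nonneg hterm)
  refine ⟨(1 + M)⁻¹, inv_pos.2 hpos, fun i hi => ?_⟩
  have hlt : |g i w| < (1 + M) * g i v := by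
    rw [← div_lt_iff₀ (hv i hi)]
    exact (Finset.single_le_sum hterm hi).trans_lt (lt_one_add M)
  rw [map_add, map_smul, smul_eq_mul, inv_mul_eq_div, ← sub_neg_eq_add, sub_pos, ← neg_div,
    div_lt_iff₀' hpos]
  exact (neg_le_abs _).trans_lt hlt

theorem exists_pos_add_smul_mem_openCone_univ [Fintype ι] (hv : v ∈ closedCone g)
    (hw : ∀ i, g i v = 0 → 0 < g i w) :
    ∃ ε : 𝕜, 0 < ε ∧ v + ε • w ∈ openCone g Finset.univ := by
  classical
  have hpos : v ∈ openCone g {i | g i v ≠ 0} := fun i hi =>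
    (hv i).lt_of_ne' (Finset.mem_filter.1 hi).2
  obtain ⟨ε, hε, hmem⟩ := exists_pos_add_smul_mem_openCone hpos w
  refine ⟨ε, hε, fun i _ => ?_⟩
  by_cases hi : g i v = 0
  · rw [map_add, map_smul, hi, zero_add]
    exact mul_pos hε (hw i hi)
  · exact hmem i (by simpa using hi)

theorem openCone_univ_subset_closedCone [Fintype ι] :
    (openCone g Finset.univ : Set V) ⊆ closedCone g :=
  fun _ hv i => (hv i (Finset.mem_univ i)).le

theorem mem_closedCone_iff_add_mem_openCone [Fintype ι]
    (hg : (openCone g Finset.univ : Set V).Nonempty) :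
    v ∈ closedCone g ↔ ∀ x ∈ openCone g Finset.univ, v + x ∈ openCone g Finset.univ := by
  refine ⟨fun hv x hx i hi => ?_, fun hv i => ?_⟩
  · rw [map_add]
    exact add_pos_of_nonneg_of_pos (hv i) (hx i hi)
  · obtain ⟨x, hx⟩ := hg
    have hx' : 0 < g i x := hx i (Finset.mem_univ i)
    refine le_of_forall_pos_lt_add fun ε hε => ?_
    have := hv _ ((openCone g Finset.univ).smul_mem (div_pos hε hx') hx) i (Finset.mem_univ i)
    rwa [map_add, map_smul, smul_eq_mul, div_mul_cancel₀ _ hx'.ne'] at this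

theorem mem_openCone_iff_exists_add_smul_mem_closedCone [Fintype ι] (hg : ∀ i, g i ≠ 0) :
    v ∈ openCone g Finset.univ ↔ ∀ w, ∃ ε : 𝕜, 0 < ε ∧ v + ε • w ∈ closedCone g := by
  refine ⟨fun hv w => ?_, fun hv i _ => ?_⟩
  · obtain ⟨ε, hε, hmem⟩ := exists_pos_add_smul_mem_openCone hv w
    exact ⟨ε, hε, openCone_univ_subset_closedCone hmem⟩
  · obtain ⟨w, hw⟩ : ∃ w, g i w < 0 := by
      obtain ⟨w, hw⟩ := DFunLike.ne_iff.1 (hg i)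
      rcases lt_or_gt_of_ne hw with hw | hw
      · exact ⟨w, hw⟩
      · exact ⟨-w, by simpa using hw⟩
    obtain ⟨ε, hε, hmem⟩ := hv w
    have := hmem i
    rw [map_add, map_smul, smul_eq_mul] at this
    linarith [mul_neg_of_pos_of_neg hε hw]

theorem openCone_eq_iff_closedCone_eq {κ : Type*} [Fintype ι] [Fintype κ]
    {h : κ → Module.Dual 𝕜 V} (hg₀ : ∀ i, g i ≠ 0) (hh₀ : ∀ k, h k ≠ 0)
    (hg : (openCone g Finset.univ : Set V).Nonempty)
    (hh : (openCone h Finset.univ : Set V).Nonempty) :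
    openCone g Finset.univ = openCone h Finset.univ ↔ closedCone g = closedCone h := by
  refine ⟨fun H => ?_, fun H => ?_⟩ <;> ext v
  · rw [mem_closedCone_iff_add_mem_openCone hg, mem_closedCone_iff_add_mem_openCone hh, H]
  · rw [mem_openCone_iff_exists_add_smul_mem_closedCone hg₀,
      mem_openCone_iff_exists_add_smul_mem_closedCone hh₀, H]

end Cones

section SignedForm

variable {R M ι : Type*} [CommRing R] [AddCommGroup M] [Module R M] {f : ι → Module.Dual R M}
  {S T : Finset ι} {i : ι} {v : M}

open Classical in
/-- The form `f i` if `i ∈ S` and `-f i` otherwise: the set `S` of indices encodes a choice of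
signs, namely of the side of each of the hyperplanes `f i = 0`. -/
noncomputable def signedForm (f : ι → Module.Dual R M) (S : Finset ι) (i : ι) : Module.Dual R M :=
  if i ∈ S then f i else -f i

theorem signedForm_of_mem (h : i ∈ S) : signedForm f S i = f i := if_pos h

theorem signedForm_of_notMem (h : i ∉ S) : signedForm f S i = -f i := if_neg h

theorem signedForm_congr (h : i ∈ S ↔ i ∈ T) : signedForm f S i = signedForm f T i := by
  classical
  exact if_congr h rfl rfl

theorem signedForm_eq_or_eq_neg : signedForm f S i = f i ∨ signedForm f S i = -f i := by
  classical
  exact ite_eq_or_eq _ _ _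

theorem signedForm_apply_eq_zero_iff : signedForm f S i v = 0 ↔ f i v = 0 := by
  rcases signedForm_eq_or_eq_neg (f := f) (S := S) (i := i) with h | h <;> simp [h]

end SignedForm

section Regions

variable {𝕜 V ι : Type*} [Field 𝕜] [LinearOrder 𝕜] [IsStrictOrderedRing 𝕜] [AddCommGroup V]
  [Module 𝕜 V] {f : ι → Module.Dual 𝕜 V} {S T A : Finset ι} {W : Submodule 𝕜 V}
  {φ : Module.Dual 𝕜 V} {v w : V} {i : ι}

theorem openCone_signedForm_congr (h : ∀ i ∈ A, i ∈ S ↔ i ∈ T) :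
    openCone (signedForm f S) A = openCone (signedForm f T) A := by
  ext v
  exact forall₂_congr fun i hi => by rw [signedForm_congr (h i hi)]

open Classical in
/-- The regions that the hyperplanes `f i = 0` with `i ∈ A` cut out of the subspace `W`, each of
them encoded by the set of the `i ∈ A` for which `f i` is positive on it. -/
noncomputable def regions (f : ι → Module.Dual 𝕜 V) (W : Submodule 𝕜 V) (A : Finset ι) :
    Finset (Finset ι) :=
  {S ∈ A.powerset | ∃ v ∈ W, v ∈ openCone (signedForm f S) A}

open Classical in
/-- The regions of `W` that meet the half-space `0 < φ`. -/
noncomputable def posRegions (f : ι → Module.Dual 𝕜 V) (W : Submodule 𝕜 V) (A : Finset ι)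
    (φ : Module.Dual 𝕜 V) : Finset (Finset ι) :=
  {S ∈ A.powerset | ∃ v ∈ W, 0 < φ v ∧ v ∈ openCone (signedForm f S) A}

theorem mem_regions :
    S ∈ regions f W A ↔ S ⊆ A ∧ ∃ v ∈ W, v ∈ openCone (signedForm f S) A := by
  simp [regions]

theorem mem_posRegions :
    S ∈ posRegions f W A φ ↔ S ⊆ A ∧ ∃ v ∈ W, 0 < φ v ∧ v ∈ openCone (signedForm f S) A := by
  simp [posRegions]

@[simp]
theorem regions_empty : regions f W ∅ = {∅} := by
  ext S
  simpa [mem_regions] using fun _ => ⟨0, W.zero_mem⟩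

theorem regions_eq_empty (hi : i ∈ A) (h : ∀ v ∈ W, f i v = 0) : regions f W A = ∅ := by
  refine Finset.eq_empty_of_forall_notMem fun S hS => ?_
  obtain ⟨-, v, hvW, hv⟩ := mem_regions.1 hS
  exact (hv i hi).ne' (signedForm_apply_eq_zero_iff.2 (h v hvW))

theorem posRegions_subset_regions : posRegions f W A φ ⊆ regions f W A := by
  intro S hS
  obtain ⟨hSA, v, hvW, -, hv⟩ := mem_posRegions.1 hS
  exact mem_regions.2 ⟨hSA, v, hvW, hv⟩

theorem regions_ker_subset_posRegions (hw : w ∈ W) (hφ : φ w ≠ 0) :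
    regions f (W ⊓ LinearMap.ker φ) A ⊆ posRegions f W A φ := by
  wlog hpos : 0 < φ w generalizing w
  · exact this (neg_mem hw) (by simpa using hφ)
      (by simpa using lt_of_le_of_ne (not_lt.1 hpos) hφ)
  intro S hS
  obtain ⟨hSA, v, ⟨hvW, hvφ⟩, hv⟩ := mem_regions.1 hS
  obtain ⟨ε, hε, hmem⟩ := exists_pos_add_smul_mem_openCone hv w
  refine mem_posRegions.2 ⟨hSA, _, W.add_mem hvW (W.smul_mem ε hw), ?_, hmem⟩
  rw [map_add, map_smul, LinearMap.mem_ker.1 hvφ, zero_add]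
  exact mul_pos hε hpos

theorem posRegions_inter_posRegions_neg_subset [DecidableEq ι] :
    posRegions f W A φ ∩ posRegions f W A (-φ) ⊆ regions f (W ⊓ LinearMap.ker φ) A := by
  intro S hS
  obtain ⟨hSA, u, huW, hφu, hu⟩ := mem_posRegions.1 (Finset.mem_inter.1 hS).1
  obtain ⟨-, v, hvW, hφv, hv⟩ := mem_posRegions.1 (Finset.mem_inter.1 hS).2
  have hker : φ ((-φ) v • u + φ u • v) = 0 := by simp [mul_comm]
  exact mem_regions.2 ⟨hSA, _, ⟨add_mem (W.smul_mem _ huW) (W.smul_mem _ hvW), hker⟩,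
    add_mem (ConvexCone.smul_mem _ hφv hu) (ConvexCone.smul_mem _ hφu hv)⟩

theorem posRegions_inter_posRegions_neg [DecidableEq ι] (hw : w ∈ W) (hφ : φ w ≠ 0) :
    posRegions f W A φ ∩ posRegions f W A (-φ) = regions f (W ⊓ LinearMap.ker φ) A := by
  refine posRegions_inter_posRegions_neg_subset.antisymm
    (Finset.subset_inter (regions_ker_subset_posRegions hw hφ) ?_)
  rw [← LinearMap.ker_neg φ]
  exact regions_ker_subset_posRegions hw (by simpa using hφ)

theorem posRegions_union_posRegions_neg [DecidableEq ι] (hw : w ∈ W) (hφ : φ w ≠ 0) :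
    posRegions f W A φ ∪ posRegions f W A (-φ) = regions f W A := by
  refine (Finset.union_subset posRegions_subset_regions posRegions_subset_regions).antisymm
    fun S hS => ?_
  obtain ⟨hSA, v, hvW, hv⟩ := mem_regions.1 hS
  rw [Finset.mem_union, mem_posRegions, mem_posRegions]
  rcases lt_trichotomy (φ v) 0 with hneg | hzero | hpos
  · exact .inr ⟨hSA, v, hvW, by simpa using hneg, hv⟩
  · exact .inl (mem_posRegions.1 (regions_ker_subset_posRegions hw hφ
      (mem_regions.2 ⟨hSA, v, ⟨hvW, hzero⟩, hv⟩)))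
  · exact .inl ⟨hSA, v, hvW, hpos, hv⟩

theorem regions_insert [DecidableEq ι] (hi : i ∉ A) :
    regions f W (insert i A) =
      (posRegions f W A (f i)).image (insert i) ∪ posRegions f W A (-f i) := by
  ext S
  have hinsert : ∀ T, openCone (signedForm f (insert i T)) A = openCone (signedForm f T) A :=
    fun T => openCone_signedForm_congr fun j hj => by
      simp [Finset.mem_insert, ne_of_mem_of_not_mem hj hi]
  simp only [Finset.mem_union, Finset.mem_image, mem_regions, mem_posRegions, mem_openCone,
    Finset.forall_mem_insert]
  constructor
  · rintro ⟨hSA, v, hvW, hvi, hv⟩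
    by_cases hiS : i ∈ S
    · rw [signedForm_of_mem hiS] at hvi
      rw [← Finset.insert_erase hiS, ← mem_openCone, hinsert] at hv
      exact .inl ⟨S.erase i, ⟨Finset.subset_insert_iff.1 hSA, v, hvW, hvi, hv⟩,
        Finset.insert_erase hiS⟩
    · rw [signedForm_of_notMem hiS] at hvi
      exact .inr ⟨(Finset.subset_insert_iff_of_notMem hiS).1 hSA, v, hvW, hvi, hv⟩
  · rintro (⟨T, ⟨hTA, v, hvW, hvi, hv⟩, rfl⟩ | ⟨hSA, v, hvW, hvi, hv⟩)
    · refine ⟨Finset.insert_subset_insert i hTA, v, hvW, ?_, ?_⟩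
      · rwa [signedForm_of_mem (Finset.mem_insert_self i T)]
      · rwa [← mem_openCone, hinsert]
    · refine ⟨hSA.trans (Finset.subset_insert i A), v, hvW, ?_, hv⟩
      rwa [signedForm_of_notMem fun hiS => hi (hSA hiS)]

/-- The new hyperplane cuts in two exactly those regions that it meets. -/
theorem card_regions_insert [DecidableEq ι] (hi : i ∉ A) (hw : w ∈ W) (h : f i w ≠ 0) :
    (regions f W (insert i A)).card =
      (regions f W A).card + (regions f (W ⊓ LinearMap.ker (f i)) A).card := by
  have hnotMem : ∀ {φ S}, S ∈ posRegions f W A φ → i ∉ S := fun hS hiS =>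
    hi ((mem_posRegions.1 hS).1 hiS)
  have hdisj : Disjoint ((posRegions f W A (f i)).image (insert i)) (posRegions f W A (-f i)) := by
    refine Finset.disjoint_left.2 fun S hS hS' => hnotMem hS' ?_
    obtain ⟨T, -, rfl⟩ := Finset.mem_image.1 hS
    exact Finset.mem_insert_self i T
  have hinj : Set.InjOn (insert i) (posRegions f W A (f i) : Set (Finset ι)) :=
    fun S hS T hT hST => by
      rw [← Finset.erase_insert (hnotMem hS), hST, Finset.erase_insert (hnotMem hT)]
  rw [regions_insert hi, Finset.card_union_of_disjoint hdisj, Finset.card_image_of_injOn hinj,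
    ← posRegions_union_posRegions_neg hw h, ← posRegions_inter_posRegions_neg hw h,
    Finset.card_union_add_card_inter]

theorem card_regions_singleton (hw : w ∈ W) (h : f i w ≠ 0) : (regions f W {i}).card = 2 := by
  classical
  rw [← insert_empty_eq, card_regions_insert (Finset.notMem_empty i) hw h, regions_empty,
    regions_empty, Finset.card_singleton]

theorem card_regions_span_singleton (hA : A.Nonempty) (h : ∀ i ∈ A, f i w ≠ 0) :
    (regions f (Submodule.span 𝕜 {w}) A).card = 2 := by
  classical
  induction hA using Finset.Nonempty.cons_induction with
  | singleton i =>
    exact card_regions_singleton (Submodule.mem_span_singleton_self w)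
      (h i (Finset.mem_singleton_self i))
  | cons i A hi hA ih =>
    rw [Finset.cons_eq_insert, Finset.forall_mem_insert] at *
    have hbot : Submodule.span 𝕜 {w} ⊓ LinearMap.ker (f i) = ⊥ := by
      refine (Submodule.eq_bot_iff _).2 fun v hv => ?_
      obtain ⟨⟨c, rfl⟩, hker⟩ := And.imp_left Submodule.mem_span_singleton.1 hv
      have hc : c * f i w = 0 := by simpa using hker
      rw [(mul_eq_zero.1 hc).resolve_right h.1, zero_smul]
    obtain ⟨j, hj⟩ := hA
    rw [card_regions_insert hi (Submodule.mem_span_singleton_self w) h.1, hbot, ih h.2,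
      regions_eq_empty hj (by simp), Finset.card_empty]

end Regions

section ProjectivePlane

variable {K V ι : Type*} [Field K] [AddCommGroup V] [Module K V] {φ ψ : Module.Dual K V}
  {p q : ℙ K V} {v : V}

/-- The hyperplane `φ = 0` of projective space; it is the whole space if `φ = 0`. -/
def projHyperplane (φ : Module.Dual K V) : Set (ℙ K V) :=
  {p | p.submodule ≤ LinearMap.ker φ}

theorem mem_projHyperplane : p ∈ projHyperplane φ ↔ p.submodule ≤ LinearMap.ker φ := Iff.rfl

theorem mk_mem_projHyperplane {hv : v ≠ 0} :
    Projectivization.mk K v hv ∈ projHyperplane φ ↔ φ v = 0 := by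
  rw [mem_projHyperplane, Projectivization.submodule_mk, Submodule.span_singleton_le_iff_mem,
    LinearMap.mem_ker]

theorem mem_projHyperplane_iff_rep : p ∈ projHyperplane φ ↔ φ p.rep = 0 := by
  conv_lhs => rw [← p.mk_rep, mk_mem_projHyperplane]

theorem projHyperplane_neg : projHyperplane (-φ) = projHyperplane φ := by
  ext p
  rw [mem_projHyperplane, mem_projHyperplane, LinearMap.ker_neg]

theorem eq_of_submodule_le (h : p.submodule ≤ q.submodule) : p = q :=
  Projectivization.submodule_injective <| by
    have := Projectivization.finrank_submodule q
    have : FiniteDimensional K q.submodule := .of_finrank_pos (by omega)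
    exact Submodule.eq_of_le_of_finrank_eq h (by simp only [Projectivization.finrank_submodule])

theorem exists_mem_ker_apply_ne_zero (h : LinearIndependent K ![φ, ψ]) :
    ∃ v ∈ LinearMap.ker φ, ψ v ≠ 0 := by
  by_contra! hker
  have hmem : ψ ∈ Submodule.span K (Set.range fun _ : Unit => φ) :=
    mem_span_of_iInf_ker_le_ker ((ciInf_const (ι := Unit)).trans_le hker)
  rw [Set.range_const, Submodule.mem_span_singleton] at hmem
  obtain ⟨c, hc⟩ := hmem
  exact (LinearIndependent.pair_iff' (h.ne_zero 0)).1 h c hc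

theorem exists_ne_zero_apply_eq_zero (hV : 2 < Module.finrank K V) (φ ψ : Module.Dual K V) :
    ∃ v, v ≠ 0 ∧ φ v = 0 ∧ ψ v = 0 := by
  have : FiniteDimensional K V := .of_finrank_pos (by omega)
  have hker : LinearMap.ker (φ.prod ψ) ≠ ⊥ :=
    LinearMap.ker_ne_bot_of_finrank_lt (by simpa using hV)
  obtain ⟨v, hv, hv₀⟩ := Submodule.exists_mem_ne_zero_of_ne_bot hker
  rw [LinearMap.mem_ker, LinearMap.prod_apply, Prod.mk_eq_zero] at hv
  exact ⟨v, hv₀, hv.1, hv.2⟩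

theorem exists_submodule_eq_ker_inf_ker (hV : Module.finrank K V = 3)
    (h : LinearIndependent K ![φ, ψ]) :
    ∃ p : ℙ K V, p.submodule = LinearMap.ker φ ⊓ LinearMap.ker ψ := by
  have : FiniteDimensional K V := .of_finrank_pos (by omega)
  set U : Subspace K (Module.Dual K V) := Submodule.span K (Set.range ![φ, ψ]) with hU
  have hUker : U.dualCoannihilator = LinearMap.ker φ ⊓ LinearMap.ker ψ := by
    ext v
    rw [← SetLike.mem_coe, hU, Submodule.coe_dualCoannihilator_span]
    simp [and_comm]
  have hUrank : Module.finrank K U = 2 := finrank_span_eq_card h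
  have hrank : Module.finrank K (LinearMap.ker φ ⊓ LinearMap.ker ψ : Submodule K V) = 1 := by
    have := Subspace.finrank_add_finrank_dualCoannihilator_eq U
    rw [hUker] at this
    omega
  exact ⟨Projectivization.mk'' _ hrank, Projectivization.submodule_mk'' _ hrank⟩

theorem eq_of_mem_projHyperplane_of_mem_projHyperplane (hV : Module.finrank K V = 3)
    (h : LinearIndependent K ![φ, ψ]) (hpφ : p ∈ projHyperplane φ) (hpψ : p ∈ projHyperplane ψ)
    (hqφ : q ∈ projHyperplane φ) (hqψ : q ∈ projHyperplane ψ) : p = q := by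
  obtain ⟨x, hx⟩ := exists_submodule_eq_ker_inf_ker hV h
  have hle : ∀ {y : ℙ K V}, y ∈ projHyperplane φ → y ∈ projHyperplane ψ → y = x := fun hφ hψ =>
    eq_of_submodule_le (hx ▸ le_inf hφ hψ)
  rw [hle hpφ hpψ, hle hqφ hqψ]

open Classical in
/-- The number of hyperplanes `f i = 0` with `i ∈ A` that pass through `p`. -/
noncomputable def mult (f : ι → Module.Dual K V) (A : Finset ι) (p : ℙ K V) : ℕ :=
  {i ∈ A | p ∈ projHyperplane (f i)}.card

/-- The linear forms `f i` define pairwise distinct lines of a projective plane. -/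
structure IsLineFamily (f : ι → Module.Dual K V) : Prop where
  finrank_eq_three : Module.finrank K V = 3
  ne_zero : ∀ i, f i ≠ 0
  pairwise_linearIndependent : Pairwise fun i j => LinearIndependent K ![f i, f j]

variable {f : ι → Module.Dual K V} {A B : Finset ι} {i j k l : ι}

theorem mult_mono (h : A ⊆ B) : mult f A p ≤ mult f B p := by
  classical
  exact Finset.card_le_card (Finset.filter_subset_filter _ h)

theorem mult_pos_iff : 0 < mult f A p ↔ ∃ j ∈ A, p ∈ projHyperplane (f j) := by
  classical
  rw [mult, Finset.card_pos, Finset.filter_nonempty_iff]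

theorem mult_le_one_iff : mult f A p ≤ 1 ↔
    ∀ i ∈ A, p ∈ projHyperplane (f i) → ∀ j ∈ A, p ∈ projHyperplane (f j) → i = j := by
  simp only [mult, Finset.card_le_one, Finset.mem_filter, and_imp]

theorem mult_le_card : mult f A p ≤ A.card := by
  classical
  exact Finset.card_filter_le _ _

theorem mult_eq_card (h : ∀ i ∈ A, p ∈ projHyperplane (f i)) : mult f A p = A.card := by
  classical
  rw [mult, Finset.filter_true_of_mem h]

theorem mult_insert_of_mem [DecidableEq ι] (hi : i ∉ A) (hp : p ∈ projHyperplane (f i)) :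
    mult f (insert i A) p = mult f A p + 1 := by
  rw [mult, Finset.filter_insert, if_pos hp, Finset.card_insert_of_notMem (by simp [hi]), mult]

theorem mult_insert_of_notMem [DecidableEq ι] (hp : p ∉ projHyperplane (f i)) :
    mult f (insert i A) p = mult f A p := by
  rw [mult, Finset.filter_insert, if_neg hp, mult]

theorem two_le_mult_univ_iff [Fintype ι] :
    2 ≤ mult f Finset.univ p ↔
      ∃ i j, i ≠ j ∧ p ∈ projHyperplane (f i) ∧ p ∈ projHyperplane (f j) := by
  rw [mult, ← Nat.lt_iff_add_one_le, Finset.one_lt_card]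
  simp only [Finset.mem_filter, Finset.mem_univ, true_and]
  grind

namespace IsLineFamily

theorem exists_submodule_eq (hf : IsLineFamily f) (hij : i ≠ j) :
    ∃ p : ℙ K V, p.submodule = LinearMap.ker (f i) ⊓ LinearMap.ker (f j) :=
  exists_submodule_eq_ker_inf_ker hf.finrank_eq_three (hf.pairwise_linearIndependent hij)

theorem eq_of_mem (hf : IsLineFamily f) (hij : i ≠ j) (hpi : p ∈ projHyperplane (f i))
    (hpj : p ∈ projHyperplane (f j)) (hqi : q ∈ projHyperplane (f i))
    (hqj : q ∈ projHyperplane (f j)) : p = q :=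
  eq_of_mem_projHyperplane_of_mem_projHyperplane hf.finrank_eq_three
    (hf.pairwise_linearIndependent hij) hpi hpj hqi hqj

theorem exists_apply_ne_zero (hf : IsLineFamily f) (i : ι) : ∃ v, f i v ≠ 0 :=
  DFunLike.ne_iff.1 (hf.ne_zero i)

variable [Finite ι]

theorem finite_setOf_mem_projHyperplane (hf : IsLineFamily f) :
    {p | ∃ i j, i ≠ j ∧ p ∈ projHyperplane (f i) ∧ p ∈ projHyperplane (f j)}.Finite := by
  have hsub : ∀ i j, {p | i ≠ j ∧ p ∈ projHyperplane (f i) ∧ p ∈ projHyperplane (f j)}.Finite :=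
    fun i j => Set.Subsingleton.finite fun p ⟨hij, hpi, hpj⟩ q ⟨_, hqi, hqj⟩ =>
      hf.eq_of_mem hij hpi hpj hqi hqj
  refine (Set.finite_iUnion fun i => Set.finite_iUnion (hsub i)).subset ?_
  rintro p ⟨i, j, h⟩
  exact Set.mem_iUnion₂.2 ⟨i, j, h⟩

/-- The points in which at least two of the lines meet. -/
noncomputable def multiplePoints (hf : IsLineFamily f) : Finset (ℙ K V) :=
  hf.finite_setOf_mem_projHyperplane.toFinset

theorem mem_multiplePoints (hf : IsLineFamily f) :
    p ∈ hf.multiplePoints ↔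
      ∃ i j, i ≠ j ∧ p ∈ projHyperplane (f i) ∧ p ∈ projHyperplane (f j) :=
  Set.Finite.mem_toFinset _

open Classical in
/-- The points on the line `f l = 0` through which some line `f j = 0` with `j ∈ A` passes, where
`l ∉ A` is intended. -/
noncomputable def pointsOn (hf : IsLineFamily f) (A : Finset ι) (l : ι) : Finset (ℙ K V) :=
  {p ∈ hf.multiplePoints | p ∈ projHyperplane (f l) ∧ 0 < mult f A p}

theorem mem_pointsOn (hf : IsLineFamily f) (hl : l ∉ A) :
    p ∈ hf.pointsOn A l ↔ p ∈ projHyperplane (f l) ∧ ∃ j ∈ A, p ∈ projHyperplane (f j) := by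
  classical
  rw [pointsOn, Finset.mem_filter, mult_pos_iff, and_iff_right_of_imp]
  rintro ⟨hpl, j, hj, hpj⟩
  exact hf.mem_multiplePoints.2 ⟨l, j, (ne_of_mem_of_not_mem hj hl).symm, hpl, hpj⟩

theorem pointsOn_insert [DecidableEq (ℙ K V)] [DecidableEq ι] (hf : IsLineFamily f)
    (hl : l ∉ insert i A) (hpl : p ∈ projHyperplane (f l)) (hpi : p ∈ projHyperplane (f i)) :
    hf.pointsOn (insert i A) l = insert p (hf.pointsOn A l) := by
  ext q
  rw [Finset.mem_insert, hf.mem_pointsOn hl,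
    hf.mem_pointsOn fun h => hl (Finset.mem_insert_of_mem h), Finset.exists_mem_insert,
    and_or_left]
  refine or_congr_left ⟨fun h => ?_, ?_⟩
  · exact hf.eq_of_mem (fun hli => hl (by simp [hli])) h.1 h.2 hpl hpi
  · rintro rfl
    exact ⟨hpl, hpi⟩

theorem sum_mult_sub_one_insert [DecidableEq ι] (hf : IsLineFamily f) (hi : i ∉ A) :
    ∑ p ∈ hf.multiplePoints, (mult f (insert i A) p - 1) =
      ∑ p ∈ hf.multiplePoints, (mult f A p - 1) + (hf.pointsOn A i).card := by
  classical
  rw [pointsOn, Finset.card_filter, ← Finset.sum_add_distrib]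
  refine Finset.sum_congr rfl fun p _ => ?_
  by_cases hp : p ∈ projHyperplane (f i)
  · rw [mult_insert_of_mem hi hp]
    grind
  · simp [mult_insert_of_notMem hp, hp]

end IsLineFamily

end ProjectivePlane

section Counting

variable {𝕜 V ι : Type*} [Field 𝕜] [LinearOrder 𝕜] [IsStrictOrderedRing 𝕜] [AddCommGroup V]
  [Module 𝕜 V] [Finite ι] {f : ι → Module.Dual 𝕜 V} {A : Finset ι} {p q : ℙ 𝕜 V} {i j l : ι}

namespace IsLineFamily

theorem card_regions_ker (hf : IsLineFamily f) (hA : A.Nonempty) (hl : l ∉ A) :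
    (regions f (LinearMap.ker (f l)) A).card = 2 * (hf.pointsOn A l).card := by
  classical
  induction hA using Finset.Nonempty.cons_induction with
  | singleton i =>
    have hli : l ≠ i := by simpa using hl
    obtain ⟨w, hw, hiw⟩ := exists_mem_ker_apply_ne_zero (hf.pairwise_linearIndependent hli)
    obtain ⟨p, hp⟩ := hf.exists_submodule_eq hli
    have hempty : hf.pointsOn ∅ l = ∅ := by simp [pointsOn, mult]
    rw [card_regions_singleton hw hiw, ← insert_empty_eq,
      hf.pointsOn_insert (by simpa using hl) (hp.trans_le inf_le_left) (hp.trans_le inf_le_right),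
      hempty, insert_empty_eq, Finset.card_singleton]
  | cons i A hi hA ih =>
    rw [Finset.cons_eq_insert] at hl ⊢
    obtain ⟨hli, hlA⟩ : l ≠ i ∧ l ∉ A := by simpa using hl
    obtain ⟨w, hw, hiw⟩ := exists_mem_ker_apply_ne_zero (hf.pairwise_linearIndependent hli)
    obtain ⟨p, hp⟩ := hf.exists_submodule_eq hli
    have hpl : p ∈ projHyperplane (f l) := hp.trans_le inf_le_left
    rw [card_regions_insert hi hw hiw, ih hlA, ← hp, p.submodule_eq,
      hf.pointsOn_insert hl hpl (hp.trans_le inf_le_right)]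
    by_cases hpA : p ∈ hf.pointsOn A l
    · obtain ⟨-, j, hj, hpj⟩ := (hf.mem_pointsOn hlA).1 hpA
      rw [Finset.insert_eq_of_mem hpA, regions_eq_empty hj, Finset.card_empty, add_zero]
      rwa [mem_projHyperplane, p.submodule_eq] at hpj
    · rw [Finset.card_insert_of_notMem hpA, card_regions_span_singleton hA, mul_add_one]
      exact fun j hj hpj => hpA <| (hf.mem_pointsOn hlA).2
        ⟨hpl, j, hj, mem_projHyperplane_iff_rep.2 hpj⟩

theorem card_regions_top (hf : IsLineFamily f) (hA : A.Nonempty) :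
    (regions f ⊤ A).card = 2 * (1 + ∑ p ∈ hf.multiplePoints, (mult f A p - 1)) := by
  classical
  induction hA using Finset.Nonempty.cons_induction with
  | singleton i =>
    obtain ⟨w, hw⟩ := hf.exists_apply_ne_zero i
    have hle : ∀ p, mult f {i} p ≤ 1 := fun p => Finset.card_filter_le _ _
    rw [card_regions_singleton Submodule.mem_top hw,
      Finset.sum_eq_zero fun p _ => Nat.sub_eq_zero_of_le (hle p), add_zero, mul_one]
  | cons i A hi hA ih =>
    obtain ⟨w, hw⟩ := hf.exists_apply_ne_zero i
    rw [Finset.cons_eq_insert, card_regions_insert hi Submodule.mem_top hw, ih, top_inf_eq,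
      hf.card_regions_ker hA hi, hf.sum_mult_sub_one_insert hi]
    ring

theorem card_regions_top_of_forall_mem (hf : IsLineFamily f) (hp : p ∈ hf.multiplePoints)
    (hA : ∀ i, i ∈ A ↔ p ∈ projHyperplane (f i)) :
    (regions f ⊤ A).card = 2 * A.card := by
  classical
  obtain ⟨i, -, -, hi, -⟩ := hf.mem_multiplePoints.1 hp
  have hAne : A.Nonempty := ⟨i, (hA i).2 hi⟩
  have hmult : mult f A p = A.card := mult_eq_card fun i hi => (hA i).1 hi
  have hle : ∀ q ≠ p, mult f A q ≤ 1 := fun q hqp => mult_le_one_iff.2 fun k hk hqk l hl hql =>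
    not_imp_comm.1 (fun hkl => hf.eq_of_mem hkl hqk hql ((hA k).1 hk) ((hA l).1 hl)) hqp
  rw [hf.card_regions_top hAne, Finset.sum_eq_single_of_mem p hp fun q _ hqp =>
    Nat.sub_eq_zero_of_le (hle q hqp), hmult, Nat.add_sub_cancel' hAne.card_pos]

end IsLineFamily

end Counting

section Essential

variable {K V ι : Type*} [Field K] [AddCommGroup V] [Module K V] {f : ι → Module.Dual K V}
  {p : ℙ K V} {S : Finset ι} {i : ι}

/-- The hyperplanes `f i = 0` have only the origin in common. -/
def IsEssential (f : ι → Module.Dual K V) : Prop :=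
  ∀ v, (∀ i, f i v = 0) → v = 0

theorem IsEssential.signedForm (hf : IsEssential f) (S : Finset ι) :
    IsEssential (signedForm f S) := fun v hv =>
  hf v fun i => signedForm_apply_eq_zero_iff.1 (hv i)

theorem projHyperplane_signedForm :
    projHyperplane (signedForm f S i) = projHyperplane (f i) := by
  rcases signedForm_eq_or_eq_neg (f := f) (S := S) (i := i) with h | h <;>
    simp only [h, projHyperplane_neg]

theorem IsLineFamily.signedForm (hf : IsLineFamily f) (S : Finset ι) :
    IsLineFamily (signedForm f S) where
  finrank_eq_three := hf.finrank_eq_three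
  ne_zero i := by
    rcases signedForm_eq_or_eq_neg (f := f) (S := S) (i := i) with h | h <;>
      simpa [h] using hf.ne_zero i
  pairwise_linearIndependent i j hij := by
    have := hf.pairwise_linearIndependent hij
    rcases signedForm_eq_or_eq_neg (f := f) (S := S) (i := i) with hi | hi <;>
      rcases signedForm_eq_or_eq_neg (f := f) (S := S) (i := j) with hj | hj <;>
      simpa [hi, hj] using this

theorem IsLineFamily.multiplePoints_signedForm [Finite ι] (hf : IsLineFamily f) (S : Finset ι) :
    (hf.signedForm S).multiplePoints = hf.multiplePoints := by
  ext p
  simp only [mem_multiplePoints, projHyperplane_signedForm]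

end Essential

section ConeVertices

variable {𝕜 V ι : Type*} [Field 𝕜] [LinearOrder 𝕜] [IsStrictOrderedRing 𝕜] [AddCommGroup V]
  [Module 𝕜 V] {f g : ι → Module.Dual 𝕜 V} {S A : Finset ι} {p : ℙ 𝕜 V} {v : V}

/-- The image of a convex cone in projective space. -/
def projImage (C : ConvexCone 𝕜 V) : Set (ℙ 𝕜 V) :=
  {p | ∃ v ∈ C, v ≠ 0 ∧ v ∈ p.submodule}

theorem mk_mem_projImage {C : ConvexCone 𝕜 V} {hv : v ≠ 0} :
    Projectivization.mk 𝕜 v hv ∈ projImage C ↔ v ∈ C ∨ -v ∈ C := by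
  simp only [projImage, Set.mem_ofPred_eq, Projectivization.submodule_mk,
    Submodule.mem_span_singleton]
  constructor
  · rintro ⟨-, hmem, hne, c, rfl⟩
    have hc : c ≠ 0 := fun hc => hne (by rw [hc, zero_smul])
    rcases hc.lt_or_gt with hneg | hpos
    · have := C.smul_mem (inv_pos.2 (neg_pos.2 hneg)) hmem
      rw [smul_smul, inv_neg, neg_mul, inv_mul_cancel₀ hc, neg_one_smul] at this
      exact .inr this
    · have := C.smul_mem (inv_pos.2 hpos) hmem
      rw [smul_smul, inv_mul_cancel₀ hc, one_smul] at this
      exact .inl this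
  · rintro (h | h)
    · exact ⟨v, h, hv, 1, one_smul _ _⟩
    · exact ⟨-v, h, neg_ne_zero.2 hv, -1, neg_one_smul _ _⟩

theorem mem_projImage_iff_rep {C : ConvexCone 𝕜 V} :
    p ∈ projImage C ↔ p.rep ∈ C ∨ -p.rep ∈ C := by
  conv_lhs => rw [← p.mk_rep, mk_mem_projImage]

open Classical in
/-- The vertices of the closed cone of `g`, as points of the projective plane. -/
noncomputable def IsLineFamily.coneVertices [Finite ι] (hg : IsLineFamily g) :
    Finset (ℙ 𝕜 V) :=
  {p ∈ hg.multiplePoints | p ∈ projImage (closedCone g).toConvexCone}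

theorem IsLineFamily.mem_coneVertices [Finite ι] (hg : IsLineFamily g) :
    p ∈ hg.coneVertices ↔
      p ∈ hg.multiplePoints ∧ p ∈ projImage (closedCone g).toConvexCone := by
  classical
  simp only [coneVertices, Finset.mem_filter]

theorem mk_mem_projImage_closedCone {hv : v ≠ 0} :
    Projectivization.mk 𝕜 v hv ∈ projImage (closedCone g).toConvexCone ↔
      v ∈ closedCone g ∨ -v ∈ closedCone g :=
  mk_mem_projImage

theorem IsEssential.eq_zero_of_mem_closedCone (hg : IsEssential g) (hv : v ∈ closedCone g)
    (hv' : -v ∈ closedCone g) : v = 0 :=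
  hg v fun i => le_antisymm (by simpa using hv' i) (hv i)

theorem mem_closedCone_signedForm :
    v ∈ closedCone (signedForm f S) ↔ ∀ i, (0 < f i v → i ∈ S) ∧ (i ∈ S → 0 ≤ f i v) := by
  refine forall_congr' fun i => ?_
  by_cases hi : i ∈ S <;> simp [signedForm_of_mem, signedForm_of_notMem, hi]

open Classical in
/-- Near `v` only the hyperplanes through `v` are visible. -/
theorem card_filter_mem_closedCone [Fintype ι] (f : ι → Module.Dual 𝕜 V) (v : V) :
    {S ∈ regions f ⊤ Finset.univ | v ∈ closedCone (signedForm f S)}.card =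
      (regions f ⊤ {i | f i v = 0}).card := by
  set A : Finset ι := {i | f i v = 0} with hA
  set P : Finset ι := {i | 0 < f i v} with hP
  have hdisj : Disjoint A P := Finset.disjoint_filter.2 fun i _ h h' => h'.ne' h
  have hmem : ∀ S, v ∈ closedCone (signedForm f S) ↔ P ⊆ S ∧ S ⊆ A ∪ P := fun S => by
    simp only [mem_closedCone_signedForm, Finset.subset_iff, hA, hP, Finset.mem_union,
      Finset.mem_filter, Finset.mem_univ, true_and, forall_and,
      le_iff_eq_or_lt (α := 𝕜), eq_comm (a := (0 : 𝕜))]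
  refine Finset.card_bij' (fun S _ => S ∩ A) (fun T _ => T ∪ P) (fun S hS => ?_) (fun T hT => ?_)
    (fun S hS => ?_) fun T hT => ?_
  · obtain ⟨hS, -⟩ := Finset.mem_filter.1 hS
    obtain ⟨-, w, -, hw⟩ := mem_regions.1 hS
    refine mem_regions.2 ⟨Finset.inter_subset_right, w, Submodule.mem_top, ?_⟩
    rw [openCone_signedForm_congr (T := S) (by simp +contextual)]
    exact fun i _ => hw i (Finset.mem_univ i)
  · obtain ⟨hTA, w, -, hw⟩ := mem_regions.1 hT
    have hv : v ∈ closedCone (signedForm f (T ∪ P)) :=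
      (hmem _).2 ⟨Finset.subset_union_right, Finset.union_subset_union_left hTA⟩
    rw [openCone_signedForm_congr (T := T ∪ P)] at hw
    · obtain ⟨ε, -, hmem⟩ := exists_pos_add_smul_mem_openCone_univ hv fun i hi =>
        hw i (by simpa [hA] using signedForm_apply_eq_zero_iff.1 hi)
      exact Finset.mem_filter.2
        ⟨mem_regions.2 ⟨Finset.subset_univ _, _, Submodule.mem_top, hmem⟩, hv⟩
    · intro i hi
      simp [Finset.disjoint_left.1 hdisj hi]
  · obtain ⟨hPS, hSA⟩ := (hmem S).1 (Finset.mem_filter.1 hS).2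
    grind
  · have hTA := (mem_regions.1 hT).1
    have := Finset.disjoint_left.1 hdisj
    grind

open Classical in
theorem card_filter_mem_projImage_closedCone [Fintype ι] (hf : IsLineFamily f)
    (hess : IsEssential f) (hp : p ∈ hf.multiplePoints) :
    {S ∈ regions f ⊤ Finset.univ | p ∈ projImage (closedCone (signedForm f S)).toConvexCone}.card =
      4 * mult f Finset.univ p := by
  have hiff : ∀ S, p ∈ projImage (closedCone (signedForm f S)).toConvexCone ↔
      p.rep ∈ closedCone (signedForm f S) ∨ -p.rep ∈ closedCone (signedForm f S) := fun S =>
    mem_projImage_iff_rep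
  have hdisj : ∀ S, p.rep ∈ closedCone (signedForm f S) →
      -p.rep ∉ closedCone (signedForm f S) := fun S h h' =>
    p.rep_nonzero ((hess.signedForm S).eq_zero_of_mem_closedCone h h')
  have hcard := hf.card_regions_top_of_forall_mem (A := {i | f i p.rep = 0}) hp
    (by simp [mem_projHyperplane_iff_rep])
  simp only [hiff]
  rw [Finset.filter_or, Finset.card_union_of_disjoint
    (Finset.disjoint_filter.2 fun S _ => hdisj S), card_filter_mem_closedCone,
    card_filter_mem_closedCone]
  simp only [map_neg, neg_eq_zero, hcard, mult, mem_projHyperplane_iff_rep]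
  ring

theorem IsLineFamily.sum_card_coneVertices [Fintype ι] (hf : IsLineFamily f)
    (hess : IsEssential f) :
    ∑ S ∈ regions f ⊤ Finset.univ, (hf.signedForm S).coneVertices.card =
      4 * ∑ p ∈ hf.multiplePoints, mult f Finset.univ p := by
  classical
  simp only [coneVertices, hf.multiplePoints_signedForm, Finset.card_filter]
  rw [Finset.sum_comm, Finset.mul_sum]
  refine Finset.sum_congr rfl fun p hp => ?_
  rw [← Finset.card_filter, card_filter_mem_projImage_closedCone hf hess hp]

end ConeVertices

section EdgeVectors

variable {𝕜 V ι : Type*} [Field 𝕜] [LinearOrder 𝕜] [IsStrictOrderedRing 𝕜] [AddCommGroup V]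
  [Module 𝕜 V] {g : ι → Module.Dual 𝕜 V} {v w : V}

/-- The nonzero vectors of the closed cone of `g` at which two of the forms vanish; if `V` is
three-dimensional, they span the edges of the cone. -/
def edgeVectors (g : ι → Module.Dual 𝕜 V) : Set V :=
  {v | v ∈ closedCone g ∧ v ≠ 0 ∧ ∃ i j, i ≠ j ∧ g i v = 0 ∧ g j v = 0}

theorem exists_pos_add_smul_mem_closedCone_card_lt [Fintype ι] (hv : v ∈ closedCone g)
    (hw : ∀ i, g i v = 0 → g i w = 0) (hneg : ∃ i, g i w < 0) :
    ∃ t : 𝕜, 0 < t ∧ v + t • w ∈ closedCone g ∧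
      Finset.card {i | g i (v + t • w) ≠ 0} < Finset.card {i | g i v ≠ 0} := by
  obtain ⟨k, hk⟩ := hneg
  obtain ⟨i, hi, hmin⟩ := Finset.exists_min_image {i | g i w < 0} (fun i => g i v / -g i w)
    ⟨k, by simpa using hk⟩
  replace hi : g i w < 0 := by simpa using hi
  have hiv : g i v ≠ 0 := fun h => hi.ne (hw i h)
  set t : 𝕜 := g i v / -g i w with ht
  have ht₀ : 0 < t := div_pos ((hv i).lt_of_ne' hiv) (neg_pos.2 hi)
  have happly : ∀ j, g j (v + t • w) = g j v + t * g j w := by simp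
  refine ⟨t, ht₀, fun j => ?_, Finset.card_lt_card ?_⟩
  · rw [happly]
    rcases lt_or_ge (g j w) 0 with hj | hj
    · have := (le_div_iff₀ (neg_pos.2 hj)).1 (hmin j (by simpa using hj))
      linarith
    · exact add_nonneg (hv j) (mul_nonneg ht₀.le hj)
  · refine (Finset.ssubset_iff_of_subset fun j hj => ?_).2 ⟨i, by simpa using hiv, ?_⟩
    · refine Finset.mem_filter.2 ⟨Finset.mem_univ j, fun hjv => (Finset.mem_filter.1 hj).2 ?_⟩
      rw [happly, hjv, hw j hjv, mul_zero, add_zero]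
    · have : g i v + t * g i w = 0 := by
        rw [ht, div_neg, neg_mul, div_mul_cancel₀ _ hi.ne, add_neg_cancel]
      simpa [happly] using this

theorem exists_apply_neg_and_apply_pos [Finite ι] (hV : 2 < Module.finrank 𝕜 V) (hg : IsEssential g)
    (hv : ¬ ∃ i j, i ≠ j ∧ g i v = 0 ∧ g j v = 0) :
    ∃ w, (∀ i, g i v = 0 → g i w = 0) ∧ (∃ i, g i w < 0) ∧ ∃ i, 0 < g i w := by
  cases nonempty_fintype ι
  obtain ⟨φ, hφ⟩ : ∃ φ : Module.Dual 𝕜 V, ∀ i, g i v = 0 → g i = φ := by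
    by_cases h : ∃ i, g i v = 0
    · obtain ⟨i, hi⟩ := h
      refine ⟨g i, fun j hj => congrArg g ?_⟩
      by_contra hne
      exact hv ⟨j, i, hne, hj, hi⟩
    · exact ⟨0, fun i hi => absurd ⟨i, hi⟩ h⟩
  -- The values of the forms at a vector killed by their sum cannot all have the same sign.
  obtain ⟨w, hw₀, hsum, hφw⟩ := exists_ne_zero_apply_eq_zero hV (∑ i, g i) φ
  rw [LinearMap.sum_apply] at hsum
  refine ⟨w, fun i hi => by rw [hφ i hi, hφw], ?_, ?_⟩ <;> by_contra! h <;>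
    refine hw₀ (hg w fun i => ?_)
  · exact (Finset.sum_eq_zero_iff_of_nonneg fun i _ => h i).1 hsum i (Finset.mem_univ i)
  · exact (Finset.sum_eq_zero_iff_of_nonpos fun i _ => h i).1 hsum i (Finset.mem_univ i)

theorem hull_edgeVectors [Finite ι] (hV : 2 < Module.finrank 𝕜 V) (hg : IsEssential g) :
    PointedCone.hull 𝕜 (edgeVectors g) = closedCone g := by
  cases nonempty_fintype ι
  refine le_antisymm (Submodule.span_le.2 fun v hv => hv.1) fun v hv => ?_
  induction hn : Finset.card {i | g i v ≠ 0} using Nat.strong_induction_on generalizing v with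
  | _ n ih =>
  subst hn
  rcases eq_or_ne v 0 with rfl | hv₀
  · exact zero_mem _
  by_cases hex : ∃ i j, i ≠ j ∧ g i v = 0 ∧ g j v = 0
  · exact PointedCone.subset_hull ⟨hv, hv₀, hex⟩
  obtain ⟨w, hw, hneg, hpos⟩ := exists_apply_neg_and_apply_pos hV hg hex
  obtain ⟨t, ht, htmem, htcard⟩ := exists_pos_add_smul_mem_closedCone_card_lt hv hw hneg
  obtain ⟨s, hs, hsmem, hscard⟩ := exists_pos_add_smul_mem_closedCone_card_lt (w := -w) hv
    (by simpa using hw) (by simpa using hpos)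
  have hcomb : (s + t) • v = s • (v + t • w) + t • (v + s • -w) := by module
  rw [← PointedCone.smul_mem_iff _ (add_pos hs ht), hcomb]
  exact add_mem (PointedCone.smul_mem _ hs.le (ih _ htcard _ htmem rfl))
    (PointedCone.smul_mem _ ht.le (ih _ hscard _ hsmem rfl))

theorem span_closedCone [Fintype ι] (hne : (openCone g Finset.univ : Set V).Nonempty) :
    Submodule.span 𝕜 (closedCone g : Set V) = ⊤ := by
  obtain ⟨x, hx⟩ := hne
  refine Submodule.eq_top_iff'.2 fun v => ?_
  obtain ⟨ε, hε, hmem⟩ := exists_pos_add_smul_mem_openCone hx v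
  have := sub_mem (Submodule.subset_span (openCone_univ_subset_closedCone hmem))
    (Submodule.subset_span (R := 𝕜) (openCone_univ_subset_closedCone hx))
  rwa [add_sub_cancel_left, Submodule.smul_mem_iff _ hε.ne'] at this

theorem span_edgeVectors [Fintype ι] (hV : 2 < Module.finrank 𝕜 V) (hg : IsEssential g)
    (hne : (openCone g Finset.univ : Set V).Nonempty) :
    Submodule.span 𝕜 (edgeVectors g) = ⊤ := by
  rw [eq_top_iff, ← span_closedCone hne, Submodule.span_le, ← hull_edgeVectors hV hg]
  exact PointedCone.hull_le_span (R := 𝕜) (edgeVectors g)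

theorem exists_basis_mem_edgeVectors [Fintype ι] (hV : Module.finrank 𝕜 V = 3) (hg : IsEssential g)
    (hne : (openCone g Finset.univ : Set V).Nonempty) :
    ∃ b : Module.Basis (Fin 3) 𝕜 V, ∀ k, b k ∈ edgeVectors g := by
  have : FiniteDimensional 𝕜 V := .of_finrank_pos (by omega)
  have hspan := (span_edgeVectors (by omega) hg hne).ge
  let b := Module.Basis.ofSpan hspan
  refine ⟨b.reindex (b.indexEquiv (Module.finBasisOfFinrankEq 𝕜 V hV)), fun k => ?_⟩
  rw [Module.Basis.reindex_apply]
  exact Module.Basis.ofSpan_subset hspan (Set.mem_range_self _)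

end EdgeVectors

section SimplicialCones

variable {𝕜 V ι : Type*} [Field 𝕜] [LinearOrder 𝕜] [IsStrictOrderedRing 𝕜] [AddCommGroup V]
  [Module 𝕜 V] {g : ι → Module.Dual 𝕜 V} {v : V} {κ : Type*}
  {b : Module.Basis κ 𝕜 V}

theorem sum_basis_mem_openCone_coord [Fintype κ] :
    ∑ k, b k ∈ openCone b.coord Finset.univ := fun k _ => by
  classical
  simp [Finsupp.single_apply]

theorem hull_range_basis [Finite κ] :
    PointedCone.hull 𝕜 (Set.range b) = closedCone b.coord := by
  classical
  cases nonempty_fintype κ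
  refine le_antisymm (Submodule.span_le.2 ?_) fun v hv => ?_
  · rintro _ ⟨k, rfl⟩ l
    rw [b.coord_apply, b.repr_self, Finsupp.single_apply]
    positivity
  · rw [← b.sum_repr v]
    exact sum_mem fun k _ => PointedCone.smul_mem _ (hv k)
      (PointedCone.subset_hull (Set.mem_range_self k))

theorem openCone_eq_openCone_coord_iff [Fintype ι] [Fintype κ] (hg₀ : ∀ i, g i ≠ 0)
    (hne : (openCone g Finset.univ : Set V).Nonempty) :
    openCone g Finset.univ = openCone b.coord Finset.univ ↔
      closedCone g = PointedCone.hull 𝕜 (Set.range b) := by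
  rw [hull_range_basis]
  exact openCone_eq_iff_closedCone_eq hg₀ (fun k h => by simpa using DFunLike.congr_fun h (b k))
    hne ⟨_, sum_basis_mem_openCone_coord⟩

theorem exists_basis_apply_eq_zero [Finite κ] (h : closedCone g = closedCone b.coord)
    (hv : v ∈ closedCone g) (hv₀ : v ≠ 0) : ∃ k, ∀ i, g i v = 0 → g i (b k) = 0 := by
  cases nonempty_fintype κ
  obtain ⟨k, hk⟩ : ∃ k, b.coord k v ≠ 0 := by
    by_contra! hzero
    exact hv₀ (b.forall_coord_eq_zero_iff.1 hzero)
  refine ⟨k, fun i hi => ?_⟩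
  have hb : ∀ l, 0 ≤ g i (b l) := fun l =>
    (h.trans hull_range_basis.symm ▸ PointedCone.subset_hull (Set.mem_range_self l) :
      b l ∈ closedCone g) i
  have hsum : ∑ l, b.coord l v * g i (b l) = 0 := by
    rw [← hi, ← congrArg (g i) (b.sum_repr v), map_sum]
    simp only [map_smul, smul_eq_mul, Module.Basis.coord_apply]
  have hmul := (Finset.sum_eq_zero_iff_of_nonneg fun l _ =>
    mul_nonneg ((h ▸ hv : v ∈ closedCone b.coord) l) (hb l)).1 hsum k (Finset.mem_univ k)
  exact (mul_eq_zero.1 hmul).resolve_left hk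

/-- The points of projective space represented by the vectors of a basis. -/
noncomputable def basisPoints [Fintype κ] (b : Module.Basis κ 𝕜 V) : Finset (ℙ 𝕜 V) :=
  Finset.univ.map ⟨fun k => .mk 𝕜 (b k) (b.ne_zero k), fun k l h => by
    obtain ⟨c, hc⟩ := (Projectivization.mk_eq_mk_iff' _ _ _ _ _).1 h
    by_contra hkl
    simpa [Finsupp.single_apply, hkl, Ne.symm hkl] using congrArg (b.repr · k) hc⟩

theorem mem_basisPoints [Fintype κ] {p : ℙ 𝕜 V} :
    p ∈ basisPoints b ↔ ∃ k, .mk 𝕜 (b k) (b.ne_zero k) = p := by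
  simp only [basisPoints, Finset.mem_map, Finset.mem_univ, true_and]
  rfl

theorem card_basisPoints [Fintype κ] : (basisPoints b).card = Fintype.card κ := by
  rw [basisPoints, Finset.card_map, Finset.card_univ]

end SimplicialCones

section Triangles

variable {𝕜 V ι : Type*} [Field 𝕜] [LinearOrder 𝕜] [IsStrictOrderedRing 𝕜] [AddCommGroup V]
  [Module 𝕜 V] {g : ι → Module.Dual 𝕜 V} {v : V}

namespace IsLineFamily

theorem mk_mem_coneVertices [Finite ι] (hg : IsLineFamily g) {hv : v ≠ 0} :
    .mk 𝕜 v hv ∈ hg.coneVertices ↔ v ∈ edgeVectors g ∨ -v ∈ edgeVectors g := by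
  simp only [mem_coneVertices, mem_multiplePoints, mk_mem_projHyperplane,
    mk_mem_projImage_closedCone]
  simp only [edgeVectors, Set.mem_ofPred_eq, map_neg, neg_eq_zero, hv, ne_eq, not_false_eq_true,
    true_and, ← or_and_right, and_comm]

theorem basisPoints_subset_coneVertices [Finite ι] (hg : IsLineFamily g) {κ : Type*} [Fintype κ]
    {b : Module.Basis κ 𝕜 V} (hb : ∀ k, b k ∈ edgeVectors g) :
    basisPoints b ⊆ hg.coneVertices := fun _ hp => by
  obtain ⟨k, rfl⟩ := mem_basisPoints.1 hp
  exact hg.mk_mem_coneVertices.2 (.inl (hb k))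

theorem three_le_card_coneVertices [Fintype ι] (hg : IsLineFamily g) (hess : IsEssential g)
    (hne : (openCone g Finset.univ : Set V).Nonempty) : 3 ≤ hg.coneVertices.card := by
  obtain ⟨b, hb⟩ := exists_basis_mem_edgeVectors hg.finrank_eq_three hess hne
  simpa [card_basisPoints] using Finset.card_le_card (hg.basisPoints_subset_coneVertices hb)

theorem hull_range_basis_of_coneVertices_subset [Finite ι] (hg : IsLineFamily g)
    (hess : IsEssential g) {κ : Type*} [Fintype κ] {b : Module.Basis κ 𝕜 V}
    (hb : ∀ k, b k ∈ edgeVectors g) (hsub : hg.coneVertices ⊆ basisPoints b) :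
    closedCone g = PointedCone.hull 𝕜 (Set.range b) := by
  rw [← hull_edgeVectors (hg.finrank_eq_three.symm ▸ by norm_num) hess]
  refine le_antisymm (Submodule.span_le.2 fun v hv => ?_)
    (Submodule.span_mono (Set.range_subset_iff.2 hb))
  obtain ⟨k, hk⟩ := mem_basisPoints.1 (hsub (hg.mk_mem_coneVertices (hv := hv.2.1).2 (.inl hv)))
  obtain ⟨c, rfl⟩ := (Projectivization.mk_eq_mk_iff' _ _ _ _ _).1 hk.symm
  have hc : 0 ≤ c := by
    by_contra! hc
    refine hv.2.1 (hess.eq_zero_of_mem_closedCone hv.1 ?_)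
    rw [← neg_smul]
    exact PointedCone.smul_mem _ (neg_nonneg.2 hc.le) (hb k).1
  exact PointedCone.smul_mem _ hc (PointedCone.subset_hull (Set.mem_range_self k))

theorem coneVertices_subset_basisPoints [Finite ι] (hg : IsLineFamily g) {κ : Type*} [Fintype κ]
    {b : Module.Basis κ 𝕜 V} (h : closedCone g = closedCone b.coord) :
    hg.coneVertices ⊆ basisPoints b := fun p hp => by
  rw [← p.mk_rep, hg.mk_mem_coneVertices] at hp
  obtain ⟨v, ⟨hv, hv₀, i, j, hij, hi, hj⟩, hvp⟩ :
      ∃ v ∈ edgeVectors g, ∀ i, g i v = 0 → p ∈ projHyperplane (g i) := by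
    simp only [mem_projHyperplane_iff_rep]
    rcases hp with hp | hp
    · exact ⟨_, hp, fun _ => id⟩
    · exact ⟨_, hp, fun _ => by simp⟩
  obtain ⟨k, hk⟩ := exists_basis_apply_eq_zero h hv hv₀
  exact mem_basisPoints.2 ⟨k, hg.eq_of_mem hij (mk_mem_projHyperplane.2 (hk i hi))
    (mk_mem_projHyperplane.2 (hk j hj)) (hvp i hi) (hvp j hj)⟩

theorem card_coneVertices_eq_three_iff [Fintype ι] (hg : IsLineFamily g) (hess : IsEssential g)
    (hne : (openCone g Finset.univ : Set V).Nonempty) :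
    hg.coneVertices.card = 3 ↔ ∃ b : Module.Basis (Fin 3) 𝕜 V,
      openCone g Finset.univ = openCone b.coord Finset.univ := by
  simp only [openCone_eq_openCone_coord_iff hg.ne_zero hne]
  constructor
  · intro hcard
    obtain ⟨b, hb⟩ := exists_basis_mem_edgeVectors hg.finrank_eq_three hess hne
    have heq := Finset.eq_of_subset_of_card_le (hg.basisPoints_subset_coneVertices hb)
      (by simp [hcard, card_basisPoints])
    exact ⟨b, hg.hull_range_basis_of_coneVertices_subset hess hb heq.ge⟩
  · rintro ⟨b, hb⟩
    refine le_antisymm ?_ (hg.three_le_card_coneVertices hess hne)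
    simpa [card_basisPoints] using Finset.card_le_card
      (hg.coneVertices_subset_basisPoints (hb.trans hull_range_basis))

end IsLineFamily

end Triangles

section Melchior

variable {K 𝕜 V ι : Type*} [Field K] [Field 𝕜] [LinearOrder 𝕜] [IsStrictOrderedRing 𝕜]
  [AddCommGroup V] [Module K V] [Module 𝕜 V] [Fintype ι]

namespace IsLineFamily

theorem sum_mult_eq_sum_mult_sub_one_add_card {f : ι → Module.Dual K V} (hf : IsLineFamily f) :
    ∑ p ∈ hf.multiplePoints, mult f Finset.univ p =
      ∑ p ∈ hf.multiplePoints, (mult f Finset.univ p - 1) + hf.multiplePoints.card := by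
  rw [Finset.card_eq_sum_ones, ← Finset.sum_add_distrib]
  refine Finset.sum_congr rfl fun p hp => (Nat.sub_add_cancel ?_).symm
  exact (two_le_mult_univ_iff.2 (hf.mem_multiplePoints.1 hp)).trans' one_le_two

variable {f : ι → Module.Dual 𝕜 V} {S : Finset ι}

theorem three_le_card_coneVertices_signedForm (hf : IsLineFamily f) (hess : IsEssential f)
    (hS : S ∈ regions f ⊤ Finset.univ) : 3 ≤ (hf.signedForm S).coneVertices.card := by
  obtain ⟨-, v, -, hv⟩ := mem_regions.1 hS
  exact (hf.signedForm S).three_le_card_coneVertices (hess.signedForm S) ⟨v, hv⟩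

theorem card_coneVertices_signedForm_eq_three_iff (hf : IsLineFamily f) (hess : IsEssential f)
    (hS : S ∈ regions f ⊤ Finset.univ) :
    (hf.signedForm S).coneVertices.card = 3 ↔ ∃ b : Module.Basis (Fin 3) 𝕜 V,
      openCone (_root_.signedForm f S) Finset.univ = openCone b.coord Finset.univ := by
  obtain ⟨-, v, -, hv⟩ := mem_regions.1 hS
  exact (hf.signedForm S).card_coneVertices_eq_three_iff (hess.signedForm S) ⟨v, hv⟩

variable [Nonempty ι]

theorem card_regions_top_univ (hf : IsLineFamily f) :
    (regions f ⊤ Finset.univ).card + 2 * hf.multiplePoints.card =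
      2 * (1 + ∑ p ∈ hf.multiplePoints, mult f Finset.univ p) := by
  rw [hf.card_regions_top Finset.univ_nonempty, hf.sum_mult_eq_sum_mult_sub_one_add_card]
  ring

/-- Melchior's inequality: each of the regions has at least three vertices. -/
theorem three_add_sum_mult_le (hf : IsLineFamily f) (hess : IsEssential f) :
    3 + ∑ p ∈ hf.multiplePoints, mult f Finset.univ p ≤ 3 * hf.multiplePoints.card := by
  have hsum := Finset.sum_le_sum fun S hS => hf.three_le_card_coneVertices_signedForm hess hS
  rw [Finset.sum_const, smul_eq_mul, hf.sum_card_coneVertices hess] at hsum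
  linarith [hf.card_regions_top_univ]

theorem three_add_sum_mult_eq_iff (hf : IsLineFamily f) (hess : IsEssential f) :
    3 + ∑ p ∈ hf.multiplePoints, mult f Finset.univ p = 3 * hf.multiplePoints.card ↔
      ∀ S ∈ regions f ⊤ Finset.univ, ∃ b : Module.Basis (Fin 3) 𝕜 V,
        openCone (_root_.signedForm f S) Finset.univ = openCone b.coord Finset.univ := by
  have heq := Finset.sum_eq_sum_iff_of_le fun S hS =>
    hf.three_le_card_coneVertices_signedForm hess hS
  rw [Finset.sum_const, smul_eq_mul, hf.sum_card_coneVertices hess] at heq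
  have hregions := hf.card_regions_top_univ
  calc _ ↔ _ := by omega
    _ ↔ _ := heq
    _ ↔ _ := forall₂_congr fun S hS =>
      eq_comm.trans (hf.card_coneVertices_signedForm_eq_three_iff hess hS)

end IsLineFamily

end Melchior

section LowerBound

variable {K V ι : Type*} [Field K] [AddCommGroup V] [Module K V] {f : ι → Module.Dual K V}
  {A B : Finset ι} {l : ι} {p : ℙ K V}

namespace IsLineFamily

theorem card_le_card_pointsOn [Finite ι] (hf : IsLineFamily f) (hl : l ∉ A) (hBA : B ⊆ A)
    (hB : ∀ p ∈ projHyperplane (f l), mult f B p ≤ 1) : B.card ≤ (hf.pointsOn A l).card := by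
  classical
  have hli : ∀ i : B, l ≠ i := fun i => (ne_of_mem_of_not_mem (hBA i.2) hl).symm
  choose p hp using fun i => hf.exists_submodule_eq (hli i)
  have hpl : ∀ i : B, p i ∈ projHyperplane (f l) := fun i => (hp i).trans_le inf_le_left
  have hpi : ∀ i : B, p i ∈ projHyperplane (f i) := fun i => (hp i).trans_le inf_le_right
  have hinj : Function.Injective p := fun i j hij =>
    Subtype.ext <| mult_le_one_iff.1 (hB _ (hpl i)) i i.2 (hpi i) j j.2 (hij ▸ hpi j)
  rw [← Finset.card_attach, ← Finset.card_image_of_injective _ hinj]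
  refine Finset.card_le_card fun q hq => ?_
  obtain ⟨i, -, rfl⟩ := Finset.mem_image.1 hq
  exact (hf.mem_pointsOn hl).2 ⟨hpl i, i, hBA i.2, hpi i⟩

theorem mult_le_one_of_mem (hf : IsLineFamily f) (hB : ∀ i ∈ B, p ∈ projHyperplane (f i))
    (hpl : p ∉ projHyperplane (f l)) {q : ℙ K V} (hq : q ∈ projHyperplane (f l)) :
    mult f B q ≤ 1 := by
  refine mult_le_one_iff.2 fun i hi hqi j hj hqj => ?_
  by_contra hij
  exact hpl (hf.eq_of_mem hij (hB i hi) (hB j hj) hqi hqj ▸ hq)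

/-- Each line that misses `p` meets the lines through `p` in pairwise different points. -/
theorem card_sub_one_add_card_mul_card_le [Finite ι] [DecidableEq ι] (hf : IsLineFamily f)
    (hp : p ∈ hf.multiplePoints) (hB : ∀ i ∈ B, p ∈ projHyperplane (f i))
    (hA : ∀ i ∈ A, p ∉ projHyperplane (f i)) :
    B.card - 1 + A.card * B.card ≤ ∑ q ∈ hf.multiplePoints, (mult f (A ∪ B) q - 1) := by
  induction A using Finset.induction_on with
  | empty =>
    rw [Finset.empty_union, Finset.card_empty, zero_mul, add_zero]
    refine le_trans ?_ (Finset.single_le_sum (fun _ _ => Nat.zero_le _) hp)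
    rw [mult_eq_card hB]
  | insert l A hl ih =>
    rw [Finset.forall_mem_insert] at hA
    have hlAB : l ∉ A ∪ B := fun h => (Finset.mem_union.1 h).elim hl fun h => hA.1 (hB l h)
    have hcard := hf.card_le_card_pointsOn hlAB Finset.subset_union_right fun q hq =>
      hf.mult_le_one_of_mem hB hA.1 hq
    rw [Finset.insert_union, hf.sum_mult_sub_one_insert hlAB, Finset.card_insert_of_notMem hl]
    linarith [ih hA.2]

theorem card_choose_two_le_of_mult_le_two [Finite ι] (hf : IsLineFamily f)
    (hA : ∀ p, mult f A p ≤ 2) :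
    A.card.choose 2 ≤ ∑ p ∈ hf.multiplePoints, (mult f A p - 1) := by
  classical
  induction A using Finset.induction_on with
  | empty => simp
  | insert l A hl ih =>
    have hcard := hf.card_le_card_pointsOn hl subset_rfl fun p hp => by
      simpa [mult_insert_of_mem hl hp] using hA p
    have hsum := ih fun p => (mult_mono (Finset.subset_insert l A)).trans (hA p)
    rw [hf.sum_mult_sub_one_insert hl, Finset.card_insert_of_notMem hl, Nat.choose_succ_succ',
      Nat.choose_one_right, one_add_one_eq_two]
    omega

theorem two_mul_card_le_of_three_le_mult [Fintype ι] (hf : IsLineFamily f)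
    (hp : 3 ≤ mult f Finset.univ p) (hp' : mult f Finset.univ p + 2 ≤ Fintype.card ι) :
    2 * Fintype.card ι ≤ 2 + ∑ p ∈ hf.multiplePoints, (mult f Finset.univ p - 1) := by
  classical
  set B : Finset ι := {i | p ∈ projHyperplane (f i)}
  have hmp : p ∈ hf.multiplePoints :=
    hf.mem_multiplePoints.2 (two_le_mult_univ_iff.1 (hp.trans' (by norm_num)))
  have hmult : mult f Finset.univ p = B.card := by rw [mult]
  have hle := hf.card_sub_one_add_card_mul_card_le (A := Bᶜ) (B := B) hmp (by simp [B])
    (by simp [B])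
  rw [Finset.union_comm, Finset.union_compl, Finset.card_compl, ← hmult] at hle
  obtain ⟨m, hm⟩ := Nat.exists_eq_add_of_le hp
  obtain ⟨n, hn⟩ := Nat.exists_eq_add_of_le hp'
  rw [show Fintype.card ι - mult f Finset.univ p = n + 2 by omega,
    show mult f Finset.univ p - 1 = m + 2 by omega, hm] at hle
  rw [hn, hm]
  nlinarith [Nat.zero_le (n * m)]

theorem two_mul_card_le [Fintype ι] (hf : IsLineFamily f) (hd : 4 ≤ Fintype.card ι)
    (hmult : ∀ p, mult f Finset.univ p + 2 ≤ Fintype.card ι) :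
    2 * Fintype.card ι ≤ 2 + ∑ p ∈ hf.multiplePoints, (mult f Finset.univ p - 1) := by
  by_cases h : ∃ p, 3 ≤ mult f Finset.univ p
  · obtain ⟨p, hp⟩ := h
    exact hf.two_mul_card_le_of_three_le_mult hp (hmult p)
  · push Not at h
    have hle := hf.card_choose_two_le_of_mult_le_two fun p => Nat.le_of_lt_succ (h p)
    have : 2 * (Fintype.card ι - 1) ≤ (Fintype.card ι).choose 2 := by
      obtain ⟨n, hn⟩ := Nat.exists_eq_add_of_le hd
      rw [hn, Nat.choose_two_right, Nat.le_div_iff_mul_le two_pos]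
      have : 4 + n - 1 = n + 3 := by omega
      rw [this]
      nlinarith
    rw [Finset.card_univ] at hle
    omega

end IsLineFamily

end LowerBound

section ProjImage

variable {𝕜 V ι κ : Type*} [Field 𝕜] [LinearOrder 𝕜] [IsStrictOrderedRing 𝕜] [AddCommGroup V]
  [Module 𝕜 V] {g : ι → Module.Dual 𝕜 V} {h : κ → Module.Dual 𝕜 V} {C D : ConvexCone 𝕜 V}
  {p : ℙ 𝕜 V} {v : V}

theorem mem_openCone_neg {A : Finset ι} : v ∈ openCone (-g) A ↔ -v ∈ openCone g A := by simp

theorem zero_notMem_openCone {A : Finset ι} (hA : A.Nonempty) : (0 : V) ∉ openCone g A := by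
  obtain ⟨i, hi⟩ := hA
  exact fun h => (h i hi).ne' (map_zero _)

theorem projImage_openCone_neg {A : Finset ι} :
    projImage (openCone (-g) A) = projImage (openCone g A) := by
  ext p
  simp only [mem_projImage_iff_rep, mem_openCone_neg, neg_neg, or_comm]

theorem eq_of_le_of_projImage_eq (hC : (0 : V) ∉ C) (hle : D ≤ C)
    (h : projImage C = projImage D) : D = C := by
  refine hle.antisymm fun v hv => ?_
  have hv₀ : v ≠ 0 := ne_of_mem_of_not_mem hv hC
  refine (mk_mem_projImage.1 (h ▸ mk_mem_projImage.2 (.inl hv) :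
    Projectivization.mk 𝕜 v hv₀ ∈ projImage D)).resolve_right fun hneg => hC ?_
  simpa using C.add_mem hv (hle hneg)

theorem le_openCone_or_le_openCone_neg [Fintype ι] [Nonempty ι] (hD : (0 : V) ∉ D)
    (h : projImage D ⊆ projImage (openCone g Finset.univ)) :
    D ≤ openCone g Finset.univ ∨ D ≤ openCone (-g) Finset.univ := by
  have hmem : ∀ v ∈ D, v ∈ openCone g Finset.univ ∨ -v ∈ openCone g Finset.univ := fun v hv =>
    mk_mem_projImage.1 (h (mk_mem_projImage.2 (.inl hv) :
      Projectivization.mk 𝕜 v (ne_of_mem_of_not_mem hv hD) ∈ _))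
  obtain ⟨i⟩ := ‹Nonempty ι›
  have hne : ∀ v ∈ D, g i v ≠ 0 := fun v hv => (hmem v hv).elim
    (fun hv => (hv i (Finset.mem_univ i)).ne')
    fun hv => by simpa using (hv i (Finset.mem_univ i)).ne
  by_contra! hnot
  obtain ⟨v, hvD, hv⟩ := Set.not_subset.1 hnot.2
  obtain ⟨w, hwD, hw⟩ := Set.not_subset.1 hnot.1
  have hgv : 0 < g i v :=
    (hmem v hvD).resolve_right (hv ∘ mem_openCone_neg.2) i (Finset.mem_univ i)
  have hgw : 0 < -g i w := by simpa using (hmem w hwD).resolve_left hw i (Finset.mem_univ i)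
  refine hne _ (D.add_mem (D.smul_mem hgw hvD) (D.smul_mem hgv hwD)) ?_
  simp [mul_comm]

theorem projImage_openCone_eq_iff [Fintype ι] [Fintype κ] [Nonempty ι] [Nonempty κ] :
    projImage (openCone g Finset.univ) = projImage (openCone h Finset.univ) ↔
      openCone g Finset.univ = openCone h Finset.univ ∨
        openCone g Finset.univ = openCone (-h) Finset.univ := by
  constructor
  · intro heq
    have h0 : ∀ h : κ → Module.Dual 𝕜 V, (0 : V) ∉ openCone h Finset.univ := fun _ =>
      zero_notMem_openCone Finset.univ_nonempty
    exact (le_openCone_or_le_openCone_neg (zero_notMem_openCone Finset.univ_nonempty)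
      heq.subset).imp (fun hle => eq_of_le_of_projImage_eq (h0 _) hle heq.symm)
      fun hle => eq_of_le_of_projImage_eq (h0 _) hle (projImage_openCone_neg.trans heq.symm)
  · rintro (heq | heq)
    · rw [heq]
    · rw [heq, projImage_openCone_neg]

theorem projImage_openCone_eq_projImage_closedCone_inter [Fintype ι] :
    projImage (openCone g Finset.univ) =
      projImage (closedCone g).toConvexCone ∩ {p | ∀ i, p ∉ projHyperplane (g i)} := by
  ext p
  simp only [Set.mem_inter_iff, Set.mem_ofPred_eq, mem_projImage_iff_rep,
    PointedCone.mem_toConvexCone, mem_projHyperplane_iff_rep, mem_openCone, mem_closedCone,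
    Finset.mem_univ, true_imp_iff, map_neg, or_and_right, ← forall_and, lt_iff_le_and_ne]
  simp only [eq_comm (a := (0 : 𝕜)), ne_eq, neg_eq_zero]

theorem nonempty_projImage_of_mem_regions {f : ι → Module.Dual 𝕜 V} {S : Finset ι}
    {W : Submodule 𝕜 V} {A : Finset ι} (hA : A.Nonempty) (hS : S ∈ regions f W A) :
    (projImage (openCone (signedForm f S) A)).Nonempty := by
  obtain ⟨-, v, -, hv⟩ := mem_regions.1 hS
  exact ⟨.mk 𝕜 v (ne_of_mem_of_not_mem hv (zero_notMem_openCone hA)),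
    mk_mem_projImage.2 (.inl hv)⟩

theorem exists_mem_regions_mem_projImage [Fintype ι] {f : ι → Module.Dual 𝕜 V}
    (hp : ∀ i, p ∉ projHyperplane (f i)) :
    ∃ S ∈ regions f ⊤ Finset.univ, p ∈ projImage (openCone (signedForm f S) Finset.univ) := by
  classical
  simp only [mem_projHyperplane_iff_rep] at hp
  have hmem : p.rep ∈ openCone (signedForm f {i | 0 < f i p.rep}) Finset.univ := fun i _ => by
    by_cases hi : 0 < f i p.rep
    · rwa [signedForm_of_mem (by simpa using hi)]
    · rw [signedForm_of_notMem (by simpa using hi), LinearMap.neg_apply, neg_pos]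
      exact (not_lt.1 hi).lt_of_ne (hp i)
  exact ⟨_, mem_regions.2 ⟨Finset.subset_univ _, p.rep, Submodule.mem_top, hmem⟩,
    mem_projImage_iff_rep.2 (.inl hmem)⟩

end ProjImage

section Components

variable {ι : Type*} {g : ι → Module.Dual ℝ (Fin 3 → ℝ)} {C : ConvexCone ℝ (Fin 3 → ℝ)} {x : RP2}

theorem preimage_projImage : Projectivization.mk' ℝ ⁻¹' projImage C =
    {v : {v : Fin 3 → ℝ // v ≠ 0} | v.1 ∈ C} ∪ {v | -v.1 ∈ C} := by
  ext v
  exact mk_mem_projImage (hv := v.2)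

theorem isOpen_projImage (hC : IsOpen (C : Set (Fin 3 → ℝ))) :
    IsOpen (projImage C : Set RP2) := by
  rw [isOpen_coinduced, preimage_projImage]
  exact (hC.preimage continuous_subtype_val).union (hC.preimage continuous_subtype_val.neg)

theorem isClosed_projImage (hC : IsClosed (C : Set (Fin 3 → ℝ))) :
    IsClosed (projImage C : Set RP2) := by
  rw [isClosed_coinduced, preimage_projImage]
  exact (hC.preimage continuous_subtype_val).union (hC.preimage continuous_subtype_val.neg)

theorem isPreconnected_projImage (hC : 0 ∉ C) :
    IsPreconnected (projImage C : Set RP2) := by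
  have himage : projImage C =
      Projectivization.mk' ℝ '' (Subtype.val ⁻¹' (C : Set (Fin 3 → ℝ))) := by
    ext x
    constructor
    · rintro ⟨v, hvC, hv, hvx⟩
      refine ⟨⟨v, hv⟩, hvC, eq_of_submodule_le ?_⟩
      rwa [Projectivization.mk'_eq_mk, Projectivization.submodule_mk,
        Submodule.span_singleton_le_iff_mem]
    · rintro ⟨v, hvC, rfl⟩
      exact mk_mem_projImage.2 (.inl hvC)
  have hrange : (C : Set (Fin 3 → ℝ)) ⊆ Set.range (Subtype.val : {v : Fin 3 → ℝ // v ≠ 0} → _) :=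
    fun v hv => ⟨⟨v, ne_of_mem_of_not_mem hv hC⟩, rfl⟩
  have hval := C.convex.isPreconnected
  rw [← Set.image_preimage_eq_of_subset hrange] at hval
  rw [himage]
  exact (Topology.IsInducing.subtypeVal.isPreconnected_image.1 hval).image _
    continuous_coinduced_rng.continuousOn

theorem isOpen_openCone [Fintype ι] : IsOpen (openCone g Finset.univ : Set (Fin 3 → ℝ)) := by
  have : (openCone g Finset.univ : Set (Fin 3 → ℝ)) = {v | ∀ i, 0 < g i v} := by ext; simp
  rw [this, Set.ofPred_forall]
  exact isOpen_iInter_of_finite fun i =>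
    isOpen_lt continuous_const (g i).continuous_of_finiteDimensional

theorem isClosed_closedCone : IsClosed (closedCone g : Set (Fin 3 → ℝ)) := by
  have : (closedCone g : Set (Fin 3 → ℝ)) = {v | ∀ i, 0 ≤ g i v} := by ext; simp
  rw [this, Set.ofPred_forall]
  exact isClosed_iInter fun i =>
    isClosed_le continuous_const (g i).continuous_of_finiteDimensional

/-- The image of the open cone is open, and closed in the complement of the lines. -/
theorem connectedComponentIn_eq_projImage_openCone [Fintype ι] [Nonempty ι]
    (hx : x ∈ projImage (openCone g Finset.univ)) :
    connectedComponentIn {x : RP2 | ∀ i, x ∉ projHyperplane (g i)} x =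
      projImage (openCone g Finset.univ) := by
  have hinter := projImage_openCone_eq_projImage_closedCone_inter (g := g)
  have hsub : projImage (openCone g Finset.univ) ⊆
      {x : RP2 | ∀ i, x ∉ projHyperplane (g i)} := hinter ▸ Set.inter_subset_right
  have hcompl : IsOpen (projImage (closedCone g).toConvexCone : Set RP2)ᶜ :=
    (isClosed_projImage (C := (closedCone g).toConvexCone) isClosed_closedCone).isOpen_compl
  refine Set.Subset.antisymm ?_ ((isPreconnected_projImage
    (zero_notMem_openCone Finset.univ_nonempty)).subset_connectedComponentIn hx hsub)
  refine isPreconnected_connectedComponentIn.subset_left_of_subset_union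
    (isOpen_projImage isOpen_openCone) hcompl ?_ (fun y hy => ?_)
    ⟨x, mem_connectedComponentIn (hsub hx), hx⟩
  · rw [Set.disjoint_compl_right_iff_subset, hinter]
    exact Set.inter_subset_left
  · rw [hinter]
    by_cases hyC : y ∈ projImage (closedCone g).toConvexCone
    · exact .inl ⟨hyC, connectedComponentIn_subset _ _ hy⟩
    · exact .inr hyC

theorem projImage_openCone_coord (b : Module.Basis (Fin 3) ℝ (Fin 3 → ℝ)) :
    projImage (openCone b.coord Finset.univ) =
      {x | ∃ c : Fin 3 → ℝ, (∀ i, 0 < c i) ∧ ∑ i, c i • b i ∈ x.submodule} := by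
  ext x
  constructor
  · rintro ⟨v, hv, -, hvx⟩
    exact ⟨b.repr v, fun i => hv i (Finset.mem_univ i), by rwa [b.sum_repr]⟩
  · rintro ⟨c, hc, hcx⟩
    have hmem : ∑ i, c i • b i ∈ openCone b.coord Finset.univ := fun i _ => by
      simpa [Finsupp.single_apply] using hc i
    exact ⟨_, hmem, ne_of_mem_of_not_mem hmem (zero_notMem_openCone Finset.univ_nonempty), hcx⟩

theorem isOpenTriangle_iff {s : Set RP2} : IsOpenTriangle s ↔
    ∃ b : Module.Basis (Fin 3) ℝ (Fin 3 → ℝ), s = projImage (openCone b.coord Finset.univ) := by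
  simp only [projImage_openCone_coord]
  constructor
  · rintro ⟨v, hv, rfl⟩
    exact ⟨basisOfLinearIndependentOfCardEqFinrank hv (by simp), by simp⟩
  · rintro ⟨b, rfl⟩
    exact ⟨b, b.linearIndependent, rfl⟩

theorem isOpenTriangle_projImage_openCone_iff [Fintype ι] [Nonempty ι] :
    IsOpenTriangle (projImage (openCone g Finset.univ)) ↔
      ∃ b : Module.Basis (Fin 3) ℝ (Fin 3 → ℝ),
        openCone g Finset.univ = openCone b.coord Finset.univ := by
  rw [isOpenTriangle_iff]
  refine ⟨?_, fun ⟨b, hb⟩ => ⟨b, by rw [hb]⟩⟩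
  rintro ⟨b, hb⟩
  rcases projImage_openCone_eq_iff.1 hb with heq | heq
  · exact ⟨b, heq⟩
  · refine ⟨b.map (LinearEquiv.neg ℝ), heq.trans ?_⟩
    ext v
    simp

end Components

section RealForms

variable {K V ι : Type*} [Field K] [AddCommGroup V] [Module K V] {φ ψ : Module.Dual K V}
  {f : ι → Module.Dual K V}

theorem isEssential_of_mult_ne_card [Fintype ι]
    (h : ∀ p, mult f Finset.univ p ≠ Fintype.card ι) : IsEssential f := by
  intro v hv
  by_contra hv₀
  exact h (.mk K v hv₀) (mult_eq_card fun i _ => mk_mem_projHyperplane.2 (hv i))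

theorem linearIndependent_of_projHyperplane_ne (hφ : φ ≠ 0) (hψ : ψ ≠ 0)
    (h : projHyperplane φ ≠ projHyperplane ψ) : LinearIndependent K ![φ, ψ] := by
  refine (LinearIndependent.pair_iff' hφ).2 ?_
  rintro c rfl
  refine h (Set.ext fun p => ?_)
  simp [mem_projHyperplane_iff_rep, left_ne_zero_of_smul hψ]

theorem zeroLocus_eq_projHyperplane (a : Fin 3 → ℂ) :
    zeroLocus a = projHyperplane (dotProductEquiv ℂ (Fin 3) a) := rfl

theorem dotProduct_complexify (a v : Fin 3 → ℝ) :
    complexify a ⬝ᵥ complexify v = ((a ⬝ᵥ v : ℝ) : ℂ) := by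
  simp [dotProduct, complexify]

theorem toCP2_mem_zeroLocus {a : Fin 3 → ℝ} {x : RP2} :
    x.toCP2 ∈ zeroLocus (complexify a) ↔ x ∈ projHyperplane (dotProductEquiv ℝ (Fin 3) a) := by
  induction x using Projectivization.ind with | h v hv => ?_
  rw [RP2.toCP2, Projectivization.map_mk, zeroLocus_eq_projHyperplane, mk_mem_projHyperplane,
    mk_mem_projHyperplane, dotProductEquiv_apply_apply, dotProductEquiv_apply_apply,
    dotProduct_complexify, Complex.ofReal_eq_zero]

theorem linearIndependent_of_complexify {a b : Fin 3 → ℝ}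
    (h : LinearIndependent ℂ ![complexify a, complexify b]) : LinearIndependent ℝ ![a, b] := by
  rw [LinearIndependent.pair_iff] at h ⊢
  intro s t hst
  have := h s t (by
    rw [← map_zero complexify, ← hst, map_add, map_smulₛₗ, map_smulₛₗ]
    rfl)
  exact_mod_cast this

theorem linearIndependent_dotProductEquiv {n : Type*} [Fintype n] [DecidableEq n] {a b : n → K} :
    LinearIndependent K ![dotProductEquiv K n a, dotProductEquiv K n b] ↔
      LinearIndependent K ![a, b] := by
  simp only [LinearIndependent.pair_iff, ← map_smul, ← map_add, LinearEquiv.map_eq_zero_iff]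

end RealForms

namespace RealLineArrangement

variable (L : RealLineArrangement)

/-- Coefficients of a real linear form that defines the line `l`. -/
noncomputable def coeffs (l : L.lines) : Fin 3 → ℝ := (L.isRealLine l l.2).choose

theorem coeffs_ne_zero (l : L.lines) : L.coeffs l ≠ 0 := (L.isRealLine l l.2).choose_spec.1

theorem eq_zeroLocus_coeffs (l : L.lines) : l.1 = zeroLocus (complexify (L.coeffs l)) :=
  (L.isRealLine l l.2).choose_spec.2

/-- The linear forms with the coefficients `L.coeffs`, over the real numbers. -/
noncomputable def realForms (l : L.lines) : Module.Dual ℝ (Fin 3 → ℝ) :=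
  dotProductEquiv ℝ (Fin 3) (L.coeffs l)

/-- The linear forms with the coefficients `L.coeffs`, over the complex numbers. -/
noncomputable def complexForms (l : L.lines) : Module.Dual ℂ (Fin 3 → ℂ) :=
  dotProductEquiv ℂ (Fin 3) (complexify (L.coeffs l))

variable {L} {l : L.lines} {p : CP2} {x : RP2} {r : ℕ}

theorem mem_projHyperplane_complexForms : p ∈ projHyperplane (L.complexForms l) ↔ p ∈ l.1 := by
  rw [L.eq_zeroLocus_coeffs l, zeroLocus_eq_projHyperplane, complexForms]

theorem toCP2_mem_iff : x.toCP2 ∈ l.1 ↔ x ∈ projHyperplane (L.realForms l) := by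
  rw [L.eq_zeroLocus_coeffs l, toCP2_mem_zeroLocus, realForms]

variable (L) in
theorem isLineFamily_complexForms : IsLineFamily L.complexForms := by
  have hne : ∀ l, L.complexForms l ≠ 0 := fun l =>
    (map_ne_zero_iff _ (dotProductEquiv ℂ (Fin 3)).injective).2
      ((map_ne_zero_iff _ complexify_injective).2 (L.coeffs_ne_zero l))
  refine ⟨by simp, hne, fun l m hlm => linearIndependent_of_projHyperplane_ne (hne l) (hne m) ?_⟩
  refine fun h => hlm (Subtype.ext (Set.ext fun p => ?_))
  rw [← mem_projHyperplane_complexForms, h, mem_projHyperplane_complexForms]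

variable (L) in
theorem isLineFamily_realForms : IsLineFamily L.realForms where
  finrank_eq_three := by simp
  ne_zero l := (map_ne_zero_iff _ (dotProductEquiv ℝ (Fin 3)).injective).2 (L.coeffs_ne_zero l)
  pairwise_linearIndependent _ _ hlm := linearIndependent_dotProductEquiv.2 <|
    linearIndependent_of_complexify <| linearIndependent_dotProductEquiv.1 <|
      L.isLineFamily_complexForms.pairwise_linearIndependent hlm

theorem mult_eq : L.mult p = _root_.mult L.complexForms Finset.univ p := by
  classical
  have himage : {l | l ∈ L.lines ∧ p ∈ l} =
      Subtype.val '' {l : L.lines | p ∈ projHyperplane (L.complexForms l)} := by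
    ext l
    simp [mem_projHyperplane_complexForms, and_comm]
  rw [mult, himage, Set.ncard_image_of_injective _ Subtype.val_injective, _root_.mult,
    ← Set.ncard_coe_finset]
  simp

theorem mult_toCP2 : L.mult x.toCP2 = _root_.mult L.realForms Finset.univ x := by
  classical
  rw [mult_eq, _root_.mult, _root_.mult]
  simp only [mem_projHyperplane_complexForms, toCP2_mem_iff]

theorem toCP2_mem_multiplePoints : x.toCP2 ∈ L.isLineFamily_complexForms.multiplePoints ↔
    x ∈ L.isLineFamily_realForms.multiplePoints := by
  simp only [IsLineFamily.mem_multiplePoints, mem_projHyperplane_complexForms, toCP2_mem_iff]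

theorem mem_multiplePoints_iff_two_le_mult :
    p ∈ L.isLineFamily_complexForms.multiplePoints ↔ 2 ≤ L.mult p := by
  rw [IsLineFamily.mem_multiplePoints, mult_eq, two_le_mult_univ_iff]

theorem image_toCP2_multiplePoints : RP2.toCP2 '' L.isLineFamily_realForms.multiplePoints =
    L.isLineFamily_complexForms.multiplePoints := by
  refine Set.Subset.antisymm (Set.image_subset_iff.2 fun _ => toCP2_mem_multiplePoints.2) ?_
  intro p hp
  obtain ⟨l, m, hlm, hl, hm⟩ := (IsLineFamily.mem_multiplePoints _).1 hp
  obtain ⟨x, hx⟩ := L.isLineFamily_realForms.exists_submodule_eq hlm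
  have hxl : x ∈ projHyperplane (L.realForms l) := hx.trans_le inf_le_left
  have hxm : x ∈ projHyperplane (L.realForms m) := hx.trans_le inf_le_right
  rw [← toCP2_mem_iff, ← mem_projHyperplane_complexForms] at hxl hxm
  have hxp : RP2.toCP2 x = p := L.isLineFamily_complexForms.eq_of_mem hlm hxl hxm hl hm
  exact ⟨x, toCP2_mem_multiplePoints.1 (hxp ▸ hp), hxp⟩

theorem injOn_toCP2 : Set.InjOn RP2.toCP2 L.isLineFamily_realForms.multiplePoints := by
  intro x hx y _ hxy
  obtain ⟨l, m, hlm, hl, hm⟩ := (IsLineFamily.mem_multiplePoints _).1 hx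
  refine L.isLineFamily_realForms.eq_of_mem hlm hl hm ?_ ?_
  · rwa [← toCP2_mem_iff, ← hxy, toCP2_mem_iff]
  · rwa [← toCP2_mem_iff, ← hxy, toCP2_mem_iff]

open Classical in
theorem t_eq (hr : 2 ≤ r) : L.t r =
    {x ∈ L.isLineFamily_realForms.multiplePoints |
      _root_.mult L.realForms Finset.univ x = r}.card := by
  have himage : {p : CP2 | L.mult p = r} =
      RP2.toCP2 '' {x ∈ L.isLineFamily_realForms.multiplePoints |
        _root_.mult L.realForms Finset.univ x = r} := by
    ext p
    simp only [← mult_toCP2]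
    constructor
    · rintro rfl
      obtain ⟨x, hx, rfl⟩ := image_toCP2_multiplePoints.ge
        (mem_multiplePoints_iff_two_le_mult.2 hr)
      exact ⟨x, ⟨hx, rfl⟩, rfl⟩
    · rintro ⟨x, ⟨-, hx⟩, rfl⟩
      exact hx
  rw [t, himage, (injOn_toCP2.mono fun x hx => hx.1).ncard_image, ← Set.ncard_coe_finset,
    Finset.coe_filter]

theorem mult_mem_Icc (hx : x ∈ L.isLineFamily_realForms.multiplePoints) :
    _root_.mult L.realForms Finset.univ x ∈ Finset.Icc 2 L.d := by
  refine Finset.mem_Icc.2 ⟨?_, mult_le_card.trans_eq (by simp [d])⟩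
  rw [← mult_toCP2, ← mem_multiplePoints_iff_two_le_mult, toCP2_mem_multiplePoints]
  exact hx

theorem f₀_eq : L.f₀ = L.isLineFamily_realForms.multiplePoints.card := by
  classical
  rw [f₀, Finset.card_eq_sum_card_fiberwise fun x => mult_mem_Icc]
  exact Finset.sum_congr rfl fun r hr => t_eq (Finset.mem_Icc.1 hr).1

theorem f₁_eq : L.f₁ =
    ∑ x ∈ L.isLineFamily_realForms.multiplePoints, _root_.mult L.realForms Finset.univ x := by
  classical
  rw [f₁, ← Finset.sum_fiberwise_of_maps_to fun x => mult_mem_Icc]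
  refine Finset.sum_congr rfl fun r hr => ?_
  rw [t_eq (Finset.mem_Icc.1 hr).1, Finset.sum_congr rfl fun x hx => (Finset.mem_filter.1 hx).2,
    Finset.sum_const, smul_eq_mul, mul_comm]

theorem mult_ne_of_t_eq_zero (hr : 2 ≤ r) (ht : L.t r = 0) (x : RP2) :
    _root_.mult L.realForms Finset.univ x ≠ r := by
  rintro rfl
  rw [t_eq hr, Finset.card_filter_eq_zero_iff] at ht
  refine ht x ?_ rfl
  rwa [← toCP2_mem_multiplePoints, mem_multiplePoints_iff_two_le_mult, mult_toCP2]

theorem isSimplicial_iff (hL : L.lines.Nonempty) : L.IsSimplicial ↔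
    ∀ S ∈ regions L.realForms ⊤ Finset.univ, ∃ b : Module.Basis (Fin 3) ℝ (Fin 3 → ℝ),
      openCone (signedForm L.realForms S) Finset.univ = openCone b.coord Finset.univ := by
  have : Nonempty L.lines := hL.coe_sort
  have hcompl : L.realComplement = {x : RP2 | ∀ l, x ∉ projHyperplane (L.realForms l)} := by
    ext x
    simp only [realComplement, Set.mem_ofPred_eq, ← toCP2_mem_iff, Subtype.forall]
  have hcomp : ∀ (S : Finset L.lines) {x : RP2},
      x ∈ projImage (openCone (signedForm L.realForms S) Finset.univ) →
      connectedComponentIn L.realComplement x =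
        projImage (openCone (signedForm L.realForms S) Finset.univ) := fun S x hx => by
    simpa only [hcompl, projHyperplane_signedForm] using
      connectedComponentIn_eq_projImage_openCone hx
  constructor
  · intro h S hS
    obtain ⟨x, hx⟩ := nonempty_projImage_of_mem_regions Finset.univ_nonempty hS
    have hxL : x ∈ L.realComplement := by
      rw [projImage_openCone_eq_projImage_closedCone_inter] at hx
      simpa only [hcompl, projHyperplane_signedForm] using hx.2
    exact isOpenTriangle_projImage_openCone_iff.1 (hcomp S hx ▸ h x hxL)
  · intro h x hx
    obtain ⟨S, hS, hxS⟩ := exists_mem_regions_mem_projImage (hcompl.le hx)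
    rw [hcomp S hxS]
    exact isOpenTriangle_projImage_openCone_iff.2 (h S hS)

theorem two_mul_logChernOneSq :
    2 * L.logChernOneSq = 5 * L.logChernTwo + (3 + L.f₁ - 3 * L.f₀) := by
  rw [logChernOneSq, logChernTwo]
  ring

theorem charNumber_le_iff (h : 0 < L.logChernTwo) :
    L.charNumber ≤ 5 / 2 ↔ 3 + L.f₁ ≤ 3 * L.f₀ := by
  rw [charNumber, div_le_div_iff₀ (by exact_mod_cast h) two_pos, mul_comm]
  norm_cast
  rw [two_mul_logChernOneSq]
  omega

theorem charNumber_eq_iff (h : 0 < L.logChernTwo) :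
    L.charNumber = 5 / 2 ↔ 3 + L.f₁ = 3 * L.f₀ := by
  rw [charNumber, div_eq_div_iff (by exact_mod_cast h.ne') two_ne_zero, mul_comm]
  norm_cast
  rw [two_mul_logChernOneSq]
  omega

theorem logChernTwo_pos (hd : 4 ≤ L.d)
    (hmult : ∀ x, _root_.mult L.realForms Finset.univ x + 2 ≤ L.d) : 0 < L.logChernTwo := by
  have hcard : Fintype.card L.lines = L.d := Fintype.card_coe _
  rw [← hcard] at hd hmult
  have hle := L.isLineFamily_realForms.two_mul_card_le hd hmult
  have hsum := L.isLineFamily_realForms.sum_mult_eq_sum_mult_sub_one_add_card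
  rw [← f₀_eq, ← f₁_eq] at hsum
  rw [hcard] at hle
  rw [logChernTwo]
  omega

end RealLineArrangement

theorem mainTheorem9 (L : RealLineArrangement) (hd : 4 ≤ L.d)
    (ht : L.t L.d = 0) (ht' : L.t (L.d - 1) = 0) :
    0 < L.logChernTwo ∧
      L.charNumber ≤ 5 / 2 ∧
      (L.charNumber = 5 / 2 ↔ L.IsSimplicial) := by
  have hcard : Fintype.card L.lines = L.d := Fintype.card_coe _
  have hnonempty : L.lines.Nonempty := Finset.card_pos.1 (by rw [← RealLineArrangement.d]; omega)
  have : Nonempty L.lines := hnonempty.coe_sort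
  have hmult : ∀ x, mult L.realForms Finset.univ x + 2 ≤ L.d := fun x => by
    have hle : mult L.realForms Finset.univ x ≤ L.d := mult_le_card.trans_eq hcard
    have hne := L.mult_ne_of_t_eq_zero (by omega) ht x
    have hne' := L.mult_ne_of_t_eq_zero (by omega) ht' x
    omega
  have hess : IsEssential L.realForms := isEssential_of_mult_ne_card fun x => by
    have := hmult x
    omega
  have hpos := L.logChernTwo_pos hd hmult
  rw [L.charNumber_le_iff hpos, L.charNumber_eq_iff hpos, L.f₀_eq, L.f₁_eq,
    L.isSimplicial_iff hnonempty]
  exact ⟨hpos, L.isLineFamily_realForms.three_add_sum_mult_le hess,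
    L.isLineFamily_realForms.three_add_sum_mult_eq_iff hess⟩
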